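/- Let $X$ be a finite weighted undirected graph with positive edge weights, possibly with loops, and without multiple edges. Write $\omega_{u,w}$ for the weight of the edge $(u,w)$ ($0$ if there is none), $A=(\omega_{u,w})$ for the adjacency matrix, $\deg(u)=2\omega_{u,u}+\sum_{w\ne u}\omega_{u,w}$ and $D=\operatorname{diag}(\deg)$. Fix $q\in\mathbb R$ and let $M=qD+A$, with characteristic polynomial $\phi(M,t)$ and spectral decomposition $M=\sum_j\lambda_jE_j$ into distinct eigenvalues $\lambda_j$ and orthogonal eigenprojections $E_j$, and let $U(t)=e^{itM}$. For vertices $u,v$ put $\sigma_u(M)=\{\lambda_j: E_j\mathbf e_u\ne 0\}$ and $\sigma^+_{uv}(M)=\{\lambda_j: E_j\mathbf e_u=E_j\mathbf e_v\neq 0\}$; $u$ and $v$ are *strongly cospectral* if $E_j\mathbf e_u=\pm E_j\mathbf e_v$ for each $j$. A vertex $u$ is *sedentary* if $\inf_{t>0}|U(t)_{u,u}|>0$, *tightly sedentary* if moreover this infimum is attained at some $t_0>0$, and *periodic* if $|U(\tau)_{u,u}|=1$ for some $\tau>0$. Two vertices $u,v$ are *twins* if they have the same neighbours outside $\{u,v\}$,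 joined to them by edges of equal weights, and $\omega_{u,u}=\omega_{v,v}$. A *twin set* $T=T(\omega,\eta)$ is a maximal set of at least two vertices that are pairwise twins, each having a loop of weight $\omega$ and any two being joined by an edge of weight $\eta$ (weight $0$ means absent). Let $T$ be a twin set and $\theta=q\deg(u)+\omega-\eta$ for $u\in T$; this is an eigenvalue of $M$ with eigenvectors $\mathbf e_u-\mathbf e_v$, $u\neq v\in T$. The largest exponent of $2$ dividing a nonzero integer $b$ is $\nu_2(b)$. **Theorem.** Each vertex in $T$ is sedentary if and only if one of the following conditions holds. 1. Either (i) $|T|\ge 3$, or (ii) $T=\{u,v\}$ and there is an eigenvector $\mathbf w$ of $M$ associated with $\theta$, orthogonal to $\mathbf e_u-\mathbf e_v$, such that $\mathbf w^T\mathbf e_u\ne0$ or $\mathbf w^T\mathbf e_v\neq 0$. 2. $T=\{u,v\}$, $u$ and $v$ are strongly cospectral, and there are integers $m_j$ such that $$\sum_{\lambda_j\in\sigma^+_{uv}(M)}m_j(\lambda_j-\theta)=0\quad\text{and}\quad\sum_{\lambda_j\in\sigma^+_{uv}(M)}m_j\ \text{ is odd}.\qquad(*)$$ If condition 1 holds,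 then no vertex in $T$ is strongly cospectral with another vertex of $X$. Condition 1 fails if and only if $T=\{u,v\}$ for two strongly cospectral vertices $u,v$; this is the case in particular whenever $\theta$ is a simple eigenvalue of $M$. Suppose now that $T=\{u,v\}$, that $u$ and $v$ are strongly cospectral and that $u$ is periodic. If integers as in $(*)$ exist, then $u$ is tightly sedentary. Such integers exist if and only if there are a real number $c>0$ and integers $b_j$ such that $\lambda_j=\theta+b_jc$ for each $\lambda_j\in\sigma^+_{uv}(M)$ and the $\nu_2(b_j)$ are not all equal. If in addition $\phi(M,t)\in\mathbb Z[t]$ and $\sigma_u(M)$ is closed under algebraic conjugation over $\mathbb Q$, then such integers exist if and only if, for some integer $\Delta$ with $\Delta=1$ or $\Delta>1$ square-free, each $\lambda_j\in\sigma^+_{uv}(M)$ is of the form $\lambda_j=\theta+b_j\sqrt\Delta$ with $b_j$ an integer, and the $\nu_2(b_j)$ are not all equal. Finally, if all entries of $M$ are rational, then $\sigma_u(M)$ is closed under algebraic conjugation over $\mathbb Q$ for each $u\in T$. -/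

import Mathlib

/-- A weighted undirected graph on `V`, possibly with loops, without multiple edges, all of whose
edge weights are positive: `u` and `v` are joined by an edge exactly when `weight u v ≠ 0`. -/
structure WeightedGraph (V : Type*) where
  weight : V → V → ℝ
  weight_symm : ∀ u v, weight u v = weight v u
  weight_nonneg : ∀ u v, 0 ≤ weight u v

namespace WeightedGraph

noncomputable section

variable {V : Type*} (X : WeightedGraph V)

/-- The neighbourhood of `u` (it contains `u` itself when there is a loop on `u`). -/
def nbhd (u : V) : Set V := {w | 0 < X.weight u w}

/-- `u` and `v` are twins. -/
def Twins (u v : V) : Prop :=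
  X.nbhd u \ {u, v} = X.nbhd v \ {u, v} ∧
  (∀ w ∈ X.nbhd u \ {u, v}, X.weight u w = X.weight v w) ∧
  X.weight u u = X.weight v v

/-- At least two vertices, pairwise twins, every loop of weight `ω`, every edge between two of them
of weight `η` (weight zero means that the loop or edge is absent). -/
def IsTwinFamily (ω η : ℝ) (T : Finset V) : Prop :=
  2 ≤ T.card ∧
  (∀ u ∈ T, ∀ v ∈ T, u ≠ v → X.Twins u v) ∧
  (∀ u ∈ T, X.weight u u = ω) ∧
  (∀ u ∈ T, ∀ v ∈ T, u ≠ v → X.weight u v = η)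

/-- `T = T(ω, η)` is a twin set. -/
def IsTwinSet (ω η : ℝ) (T : Finset V) : Prop := Maximal (X.IsTwinFamily ω η) T

variable [Fintype V] [DecidableEq V]

/-- The degree, in which loops count twice. -/
def deg (u : V) : ℝ := 2 * X.weight u u + ∑ j ∈ Finset.univ.erase u, X.weight u j

/-- The adjacency matrix `A`. -/
def adjMat : Matrix V V ℝ := Matrix.of X.weight

/-- The generalized adjacency matrix `M_q = q D + A`. -/
def genAdj (q : ℝ) : Matrix V V ℝ := q • Matrix.diagonal X.deg + X.adjMat

end

end WeightedGraph

namespace QuantumWalk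

noncomputable section

open scoped Classical in
/-- The distinct real eigenvalues of `M`. -/
def eigenvalues {V : Type*} [Fintype V] [DecidableEq V] (M : Matrix V V ℝ) : Finset ℝ :=
  M.charpoly.roots.toFinset

variable {V : Type*} [Fintype V] [DecidableEq V] (M : Matrix V V ℝ)

/-- The vector `E_lam e_u`, where `E_lam` is the orthogonal projection of `ℝ^V`
onto the eigenspace of `M` for `lam`. -/
def projVec (lam : ℝ) (u : V) : EuclideanSpace ℝ V :=
  (Module.End.eigenspace (Matrix.toEuclideanLin M) lam).starProjection (EuclideanSpace.single u 1)

open scoped Classical in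
/-- The eigenvalue support `σ_u(M)`. -/
def support (u : V) : Finset ℝ := (eigenvalues M).filter fun lam => projVec M lam u ≠ 0

open scoped Classical in
/-- `σ_uv^+(M)`: the eigenvalues with `E e_u = E e_v ≠ 0`. -/
def plusSupport (u v : V) : Finset ℝ :=
  (support M u).filter fun lam => projVec M lam u = projVec M lam v

/-- `u` and `v` are strongly cospectral. -/
def StronglyCospectral (u v : V) : Prop :=
  ∀ lam ∈ eigenvalues M, projVec M lam u = projVec M lam v ∨ projVec M lam u = -projVec M lam v

/-- The transition matrix `U_M(t) = exp(i t M)`. -/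
def U (t : ℝ) : Matrix V V ℂ := NormedSpace.exp ((Complex.I * (t : ℂ)) • M.map Complex.ofReal)

/-- `u` is periodic. -/
def IsPeriodic (u : V) : Prop := ∃ τ : ℝ, 0 < τ ∧ ‖U M τ u u‖ = 1

/-- `u` is `C`-sedentary. -/
def IsCSedentary (C : ℝ) (u : V) : Prop :=
  0 < C ∧ C ≤ 1 ∧ C ≤ ⨅ t : Set.Ioi (0 : ℝ), ‖U M t u u‖

/-- `u` is sedentary. -/
def IsSedentary (u : V) : Prop := ∃ C : ℝ, IsCSedentary M C u

/-- `u` is tightly sedentary: it is `C`-sedentary for `C` the infimum, and the infimum is attained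
at a positive time. -/
def IsTightlySedentary (u : V) : Prop :=
  ∃ C : ℝ, IsCSedentary M C u ∧ C = ⨅ t : Set.Ioi (0 : ℝ), ‖U M t u u‖ ∧
    ∃ t₀ : ℝ, 0 < t₀ ∧ ‖U M t₀ u u‖ = C

/-- `M w = θ w` for some `w` orthogonal to `e_u - e_v` that is nonzero on `u` or on `v`. -/
def HasExtraEigenvector (θ : ℝ) (u v : V) : Prop :=
  ∃ w : V → ℝ, M.mulVec w = θ • w ∧ w ⬝ᵥ (Pi.single u 1 - Pi.single v 1) = 0 ∧
    (w u ≠ 0 ∨ w v ≠ 0)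

/-- There are integers `m_j` with `∑ m_j (lam_j - θ) = 0` and `∑ m_j` odd, the sums running over
`σ_uv^+(M)`. -/
def HasOddRelation (θ : ℝ) (u v : V) : Prop :=
  ∃ m : ℝ → ℤ, ∑ lam ∈ plusSupport M u v, (m lam : ℝ) * (lam - θ) = 0 ∧
    Odd (∑ lam ∈ plusSupport M u v, m lam)

/-- Every `lam_j` in `σ_uv^+(M)` is `θ + b_j c` with `b_j` an integer, and the `ν₂(b_j)` are
not all equal. -/
def TwoAdicForm (θ c : ℝ) (u v : V) : Prop :=
  ∃ b : ℝ → ℤ, (∀ lam ∈ plusSupport M u v, lam = θ + (b lam : ℝ) * c) ∧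
    ¬ ∀ lam ∈ plusSupport M u v, ∀ mu ∈ plusSupport M u v,
      padicValInt 2 (b lam) = padicValInt 2 (b mu)

/-- The characteristic polynomial of `M` has integer coefficients. -/
def HasIntegralCharpoly : Prop :=
  ∃ p : Polynomial ℤ, p.map (Int.castRingHom ℝ) = M.charpoly

/-- `σ_u(M)` is closed under algebraic conjugation over `ℚ`. -/
def SupportConjClosed (u : V) : Prop :=
  ∀ lam ∈ support M u, ∀ mu : ℝ, IsConjRoot ℚ lam mu → mu ∈ support M u

/-- `θ` is a simple eigenvalue of `M`. -/
def IsSimpleEigenvalue (θ : ℝ) : Prop := M.charpoly.rootMultiplicity θ = 1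

/-- The first condition: `|T| ≥ 3`, or `T = {u, v}` and there is an extra eigenvector for `θ`. -/
def LargeOrExtra (θ : ℝ) (T : Finset V) : Prop :=
  3 ≤ T.card ∨ ∃ u v : V, u ≠ v ∧ T = {u, v} ∧ HasExtraEigenvector M θ u v

/-- The second condition: `T = {u, v}` with `u` and `v` strongly cospectral, and there is an
integer relation with odd coefficient sum. -/
def CospectralPairWithOddRelation (θ : ℝ) (T : Finset V) : Prop :=
  ∃ u v : V, u ≠ v ∧ T = {u, v} ∧ StronglyCospectral M u v ∧ HasOddRelation M θ u v

end

end QuantumWalk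

/-!
Write `M = ∑ λ E_λ`. The return amplitude `U(t)_{u,u} = ∑_λ ‖E_λ e_u‖² e^{itλ}` is the Fourier
transform of the spectral measure of `e_u`, and everything is decided by the mass `‖E_θ e_u‖²`
which this measure puts on the eigenvalue `θ` of the twin set.

For twins `u`, `v` the vector `e_u - e_v` is a `θ`-eigenvector, so `E_λ e_u = E_λ e_v` for `λ ≠ θ`,
and `‖E_θ e_u + E_θ e_v‖² = 4 ‖E_θ e_u‖² - 2`. Hence the mass is at least `1/2`; it equals `1/2`
exactly if `u` and `v` are strongly cospectral (`stronglyCospectral_iff`), and it exceeds `1/2`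
exactly if there is an extra eigenvector (`hasExtraEigenvector_iff`), for instance
`e_u + e_v - 2 e_w` with a third twin `w`. In the latter case the term of `θ` dominates the
amplitude, which makes `u` sedentary and prevents strong cospectrality with any other vertex.

If the mass is `1/2`, then `|U(t)_{u,u}| = |1 / 2 + ∑ a_λ e^{it(λ - θ)}|`, with positive `a_λ`
that sum to `1/2`. This comes arbitrarily close to `0` if and only if all phases `e^{it(λ - θ)}`
can be brought simultaneously close to `-1`. An integer relation between the `λ - θ` with odd
coefficient sum confines the phases to a closed subgroup of the torus that misses `(-1, …, -1)`
(`isSedentary_of_odd_relation`). Without such a relation, Kronecker's theorem applies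
(`exists_lt_norm_sum_exp`).

A period puts the support into an arithmetic progression through `θ`; it makes the amplitude
periodic in absolute value, so that its infimum is attained, and reduces odd relations to a
comparison of `2`-adic valuations (`exists_odd_relation_iff`). If the support is closed under
conjugation, its power sums are rational, whence so is the square of the common difference;
together with integrality this gives the form `θ + b √Δ` (`exists_squarefree_of_isPeriodic`). For
rational `M` the entry `(E_λ)_{u,u}` is, up to a nonzero factor, the value at `λ` of a fixed
rational polynomial, so that it vanishes at all conjugates of `λ` or at none
(`supportConjClosed_of_rational`).
-/

/-! ### Spectral decomposition -/

namespace QuantumWalk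

open scoped InnerProductSpace

variable {V : Type*} [Fintype V] [DecidableEq V] {M : Matrix V V ℝ}

theorem charpoly_toEuclideanLin : (Matrix.toEuclideanLin M).charpoly = M.charpoly := by
  rw [Matrix.toEuclideanLin, Matrix.toLpLin_eq_toLin, Matrix.charpoly_toLin]

theorem mem_eigenvalues_iff {l : ℝ} :
    l ∈ eigenvalues M ↔ Module.End.eigenspace (Matrix.toEuclideanLin M) l ≠ ⊥ := by
  have h2 := Module.End.hasEigenvalue_iff_isRoot_charpoly (Matrix.toEuclideanLin M) l
  rw [charpoly_toEuclideanLin] at h2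
  rw [eigenvalues, Multiset.mem_toFinset,
    Polynomial.mem_roots (Matrix.charpoly_monic M).ne_zero, ← h2]
  exact Module.End.hasEigenvalue_iff

theorem projVec_mem (l : ℝ) (u : V) :
    projVec M l u ∈ Module.End.eigenspace (Matrix.toEuclideanLin M) l :=
  Submodule.starProjection_apply_mem _ _

theorem mulVec_projVec (l : ℝ) (u : V) :
    M.mulVec (projVec M l u).ofLp = l • (projVec M l u).ofLp := by
  have h := Module.End.mem_eigenspace_iff.1 (projVec_mem (M := M) l u)
  simpa using congrArg WithLp.ofLp h

theorem projVec_eq_zero_of_notMem {l : ℝ} (hl : l ∉ eigenvalues M) (u : V) :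
    projVec M l u = 0 := by
  have h : Module.End.eigenspace (Matrix.toEuclideanLin M) l = ⊥ := by
    by_contra h; exact hl (mem_eigenvalues_iff.2 h)
  have := projVec_mem (M := M) l u
  rw [h] at this
  simpa using this

/-- For `w` in the `l`-eigenspace, the pairing with `E_l e_u` reads off the `u`-coordinate. -/
theorem inner_projVec_of_mem {l : ℝ} {w : EuclideanSpace ℝ V}
    (hw : w ∈ Module.End.eigenspace (Matrix.toEuclideanLin M) l) (u : V) :
    ⟪projVec M l u, w⟫_ℝ = w u := by
  rw [projVec, Submodule.inner_starProjection_left_eq_right,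
    Submodule.starProjection_eq_self_iff.2 hw, EuclideanSpace.inner_single_left]
  simp

theorem inner_eigenspaces (hM : M.IsHermitian) {l m : ℝ} (hlm : l ≠ m) {x y : EuclideanSpace ℝ V}
    (hx : x ∈ Module.End.eigenspace (Matrix.toEuclideanLin M) l)
    (hy : y ∈ Module.End.eigenspace (Matrix.toEuclideanLin M) m) : ⟪x, y⟫_ℝ = 0 :=
  (Matrix.isSymmetric_toEuclideanLin_iff.2 hM).orthogonalFamily_eigenspaces hlm ⟨x, hx⟩ ⟨y, hy⟩

theorem sum_projVec (hM : M.IsHermitian) (u : V) :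
    ∑ l ∈ eigenvalues M, projVec M l u = EuclideanSpace.single u 1 := by
  have hT := Matrix.isSymmetric_toEuclideanLin_iff.2 hM
  have h := hT.orthogonalComplement_iSup_eigenspaces_eq_bot
  have key : EuclideanSpace.single u (1 : ℝ) - ∑ l ∈ eigenvalues M, projVec M l u ∈
      (⨆ μ, Module.End.eigenspace (Matrix.toEuclideanLin M) μ)ᗮ := by
    rw [← Submodule.iInf_orthogonal, Submodule.mem_iInf]
    intro μ
    rw [Submodule.mem_orthogonal']
    intro w hw
    rw [inner_sub_left, sum_inner, EuclideanSpace.inner_single_left]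
    by_cases hμ : μ ∈ eigenvalues M
    · rw [Finset.sum_eq_single_of_mem μ hμ, inner_projVec_of_mem hw]
      · simp
      · intro l _ hl
        exact inner_eigenspaces hM hl (projVec_mem l u) hw
    · have hb : Module.End.eigenspace (Matrix.toEuclideanLin M) μ = ⊥ := by
        by_contra h; exact hμ (mem_eigenvalues_iff.2 h)
      rw [hb, Submodule.mem_bot] at hw
      simp [hw]
  rw [h, Submodule.mem_bot, sub_eq_zero] at key
  exact key.symm

/-- The diagonal entry `(E_l)_{u,u} = ‖E_l e_u‖²` of the spectral idempotent: the mass which the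
spectral measure of `e_u` puts on `l`. -/
noncomputable def mass (M : Matrix V V ℝ) (l : ℝ) (u : V) : ℝ := ‖projVec M l u‖ ^ 2

theorem mass_nonneg (l : ℝ) (u : V) : 0 ≤ mass M l u := sq_nonneg _

theorem mass_pos_iff {l : ℝ} {u : V} : 0 < mass M l u ↔ projVec M l u ≠ 0 := by
  simp [mass, sq_pos_iff]

theorem projVec_apply_self (l : ℝ) (u : V) : projVec M l u u = mass M l u := by
  rw [mass, ← real_inner_self_eq_norm_sq, inner_projVec_of_mem (projVec_mem l u)]

theorem mem_support_iff {l : ℝ} {u : V} : l ∈ support M u ↔ projVec M l u ≠ 0 := by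
  rw [support, Finset.mem_filter]
  refine ⟨fun h => h.2, fun h => ⟨?_, h⟩⟩
  by_contra hl
  exact h (projVec_eq_zero_of_notMem hl u)

theorem sum_mass_eigenvalues (hM : M.IsHermitian) (u : V) :
    ∑ l ∈ eigenvalues M, mass M l u = 1 := by
  have h := congrArg (fun x : EuclideanSpace ℝ V => x u) (sum_projVec hM u)
  simp only [WithLp.ofLp_sum, Finset.sum_apply, projVec_apply_self] at h
  simpa using h

theorem sum_mass_support (hM : M.IsHermitian) (u : V) : ∑ l ∈ support M u, mass M l u = 1 := by
  rw [← sum_mass_eigenvalues hM u, support, Finset.sum_filter_of_ne]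
  intro l _ hl h0
  exact hl (by simp [mass, h0])

theorem aeval_apply_self (hM : M.IsHermitian) (p : Polynomial ℝ) (u : V) :
    (Polynomial.aeval M p) u u = ∑ l ∈ support M u, p.eval l * mass M l u := by
  have h1 : ∀ l, (Polynomial.aeval M p).mulVec (projVec M l u).ofLp =
      p.eval l • (projVec M l u).ofLp := by
    intro l
    have hx : Matrix.toLin' M (projVec M l u).ofLp = l • (projVec M l u).ofLp := by
      simpa using mulVec_projVec (M := M) l u
    have h3 : Polynomial.aeval (Matrix.toLin' M) p (projVec M l u).ofLp =
        p.eval l • (projVec M l u).ofLp := by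
      by_cases h0 : (projVec M l u).ofLp = 0
      · simp [h0]
      · exact Module.End.aeval_apply_of_hasEigenvector ⟨Module.End.mem_eigenspace_iff.2 hx, h0⟩
    have h4 : Polynomial.aeval (Matrix.toLin' M) p = Matrix.toLin' (Polynomial.aeval M p) := by
      have := Polynomial.aeval_algHom_apply (Matrix.toLinAlgEquiv' (R := ℝ) (n := V)) M p
      exact this
    rw [h4] at h3
    simpa using h3
  have h2 : (Polynomial.aeval M p) u u =
      (Polynomial.aeval M p).mulVec (EuclideanSpace.single u (1 : ℝ)).ofLp u := by
    simp
  rw [h2, ← sum_projVec hM u, WithLp.ofLp_sum, Matrix.mulVec_sum]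
  simp only [h1, Finset.sum_apply, Pi.smul_apply, projVec_apply_self, smul_eq_mul]
  rw [support, Finset.sum_filter_of_ne]
  intro l _ hl h0
  exact hl (by simp [mass, h0])

theorem exp_mulVec_of_mulVec_eq {A : Matrix V V ℂ} {x : V → ℂ} {c : ℂ}
    (h : A.mulVec x = c • x) : (NormedSpace.exp A).mulVec x = Complex.exp c • x := by
  have hpow : ∀ n : ℕ, (A ^ n).mulVec x = c ^ n • x := by
    intro n
    induction n with
    | zero => simp
    | succ k ih => rw [pow_succ, ← Matrix.mulVec_mulVec, h, Matrix.mulVec_smul, ih, smul_smul,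
        pow_succ, mul_comm]
  let _ : NormedRing (Matrix V V ℂ) := Matrix.linftyOpNormedRing
  let _ : NormedAlgebra ℂ (Matrix V V ℂ) := Matrix.linftyOpNormedAlgebra
  have h1 := NormedSpace.exp_series_hasSum_exp' (𝕂 := ℂ) A
  have h2 := h1.map ((Matrix.mulVecBilin ℂ ℂ).flip x : Matrix V V ℂ →ₗ[ℂ] V → ℂ)
    (LinearMap.continuous_of_finiteDimensional _)
  have h3 := (NormedSpace.exp_series_hasSum_exp' (𝕂 := ℂ) c).smul_const x
  rw [← Complex.exp_eq_exp_ℂ] at h3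
  refine h2.unique ?_
  convert h3 using 2 with n
  simp [hpow, smul_smul]

/-- The diagonal entry of the transition matrix is the Fourier transform of the spectral
measure of `e_u`. -/
theorem U_apply_self (hM : M.IsHermitian) (t : ℝ) (u : V) :
    U M t u u = ∑ l ∈ support M u, (mass M l u : ℂ) * Complex.exp (Complex.I * t * l) := by
  have h1 : ∀ l : ℝ, (U M t).mulVec (fun v => ((projVec M l u v : ℝ) : ℂ)) =
      Complex.exp (Complex.I * t * l) • fun v => ((projVec M l u v : ℝ) : ℂ) := by
    intro l
    apply exp_mulVec_of_mulVec_eq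
    rw [Matrix.smul_mulVec, mul_smul (Complex.I * t)]
    refine congrArg _ (funext fun v => ?_)
    have := congrFun (mulVec_projVec (M := M) l u) v
    simp only [Matrix.mulVec, dotProduct, Pi.smul_apply, smul_eq_mul, Matrix.map_apply] at this ⊢
    exact_mod_cast congrArg Complex.ofReal this
  have h0 : (Pi.single u 1 : V → ℂ) = ∑ l ∈ eigenvalues M,
      fun v => ((projVec M l u v : ℝ) : ℂ) := by
    ext v
    have h := congrArg (fun x : EuclideanSpace ℝ V => x v) (sum_projVec hM u)
    simp only [WithLp.ofLp_sum, Finset.sum_apply] at h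
    rw [Finset.sum_apply, ← Complex.ofReal_sum, h]
    by_cases hv : v = u
    · subst hv; simp
    · simp [hv]
  have h2 : U M t u u = (U M t).mulVec (Pi.single u 1) u := by simp
  rw [h2, h0, Matrix.mulVec_sum]
  simp only [h1, Finset.sum_apply, Pi.smul_apply, projVec_apply_self, smul_eq_mul]
  rw [support, Finset.sum_filter_of_ne]
  · exact Finset.sum_congr rfl fun l _ => mul_comm _ _
  · intro l _ hl h0
    exact hl (by simp [mass, h0])

theorem isSedentary_iff {u : V} :
    IsSedentary M u ↔ ∃ C : ℝ, 0 < C ∧ ∀ t : ℝ, 0 < t → C ≤ ‖U M t u u‖ := by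
  have : Nonempty (Set.Ioi (0 : ℝ)) := ⟨⟨1, one_pos (α := ℝ)⟩⟩
  have hb : BddBelow (Set.range fun t : Set.Ioi (0 : ℝ) => ‖U M t u u‖) :=
    ⟨0, by rintro _ ⟨t, rfl⟩; exact norm_nonneg _⟩
  constructor
  · rintro ⟨C, h0, -, h⟩
    exact ⟨C, h0, fun t ht => h.trans (ciInf_le hb ⟨t, ht⟩)⟩
  · rintro ⟨C, h0, h⟩
    exact ⟨min C 1, lt_min h0 one_pos, min_le_right _ _,
      le_ciInf fun t => (min_le_left _ _).trans (h t t.2)⟩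

end QuantumWalk

/-! ### Inhomogeneous approximation for exponential sums -/

namespace QuantumWalk

open Filter Topology

theorem tendsto_mean_exp (μ : ℝ) :
    Tendsto (fun T : ℝ => (T : ℂ)⁻¹ * ∫ t in (0 : ℝ)..T, Complex.exp (Complex.I * t * μ)) atTop
      (𝓝 (if μ = 0 then 1 else 0)) := by
  split_ifs with hμ
  · subst hμ
    refine tendsto_const_nhds.congr' ?_
    filter_upwards [eventually_gt_atTop 0] with T hT
    have : (T : ℂ) ≠ 0 := by exact_mod_cast hT.ne'
    simp [this]
  · have hc : Complex.I * (μ : ℂ) ≠ 0 := mul_ne_zero Complex.I_ne_zero (by exact_mod_cast hμ)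
    have hb : ∀ T : ℝ, ‖∫ t in (0 : ℝ)..T, Complex.exp (Complex.I * t * μ)‖ ≤ 2 / |μ| := by
      intro T
      have h1 : ∀ t : ℝ, Complex.exp (Complex.I * t * μ) = Complex.exp (Complex.I * μ * t) :=
        fun t => by ring_nf
      simp only [h1]
      rw [integral_exp_mul_complex hc, norm_div]
      have h2 : ‖Complex.I * (μ : ℂ)‖ = |μ| := by simp
      rw [h2]
      gcongr
      refine (norm_sub_le _ _).trans ?_
      have h3 : ∀ t : ℝ, ‖Complex.exp (Complex.I * μ * t)‖ = 1 := fun t => by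
        rw [show Complex.I * (μ : ℂ) * t = ((μ * t : ℝ) : ℂ) * Complex.I by push_cast; ring,
          Complex.norm_exp_ofReal_mul_I]
      rw [h3, h3]
      norm_num
    rw [tendsto_zero_iff_norm_tendsto_zero]
    have h4 : Tendsto (fun T : ℝ => T⁻¹ * (2 / |μ|)) atTop (𝓝 0) := by
      simpa using tendsto_inv_atTop_zero.mul_const (2 / |μ|)
    refine squeeze_zero' (Eventually.of_forall fun _ => norm_nonneg _) ?_ h4
    filter_upwards [eventually_gt_atTop 0] with T hT
    rw [norm_mul, norm_inv, Complex.norm_real, Real.norm_of_nonneg hT.le]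
    gcongr
    exact hb T

/-- The mean value of an exponential sum, its coefficient at frequency zero, is bounded by any
bound for the sum on the positive half-line. -/
theorem norm_sum_freq_zero_le {ι : Type*} (s : Finset ι) (c : ι → ℂ) (μ : ι → ℝ) {B : ℝ}
    (h : ∀ t : ℝ, 0 < t → ‖∑ i ∈ s, c i * Complex.exp (Complex.I * t * μ i)‖ ≤ B) :
    ‖∑ i ∈ s with μ i = 0, c i‖ ≤ B := by
  have h1 : Tendsto (fun T : ℝ => ∑ i ∈ s, c i * ((T : ℂ)⁻¹ *
      ∫ t in (0 : ℝ)..T, Complex.exp (Complex.I * t * μ i))) atTop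
      (𝓝 (∑ i ∈ s, c i * if μ i = 0 then 1 else 0)) :=
    tendsto_finsetSum _ fun i _ => (tendsto_mean_exp (μ i)).const_mul (c i)
  have h2 : ∑ i ∈ s, c i * (if μ i = 0 then 1 else 0) = ∑ i ∈ s with μ i = 0, c i := by
    simp [Finset.sum_filter]
  rw [h2] at h1
  refine le_of_tendsto h1.norm ?_
  filter_upwards [eventually_gt_atTop 0] with T hT
  have h3 : ∑ i ∈ s, c i * ((T : ℂ)⁻¹ * ∫ t in (0 : ℝ)..T, Complex.exp (Complex.I * t * μ i)) =
      (T : ℂ)⁻¹ * ∫ t in (0 : ℝ)..T, ∑ i ∈ s, c i * Complex.exp (Complex.I * t * μ i) := by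
    rw [intervalIntegral.integral_finsetSum, Finset.mul_sum]
    · refine Finset.sum_congr rfl fun i _ => ?_
      rw [intervalIntegral.integral_const_mul]
      ring
    · intro i _
      exact Continuous.intervalIntegrable (by fun_prop) _ _
  rw [h3, norm_mul, norm_inv, Complex.norm_real, Real.norm_of_nonneg hT.le,
    inv_mul_le_iff₀ hT]
  have h4 := intervalIntegral.norm_integral_le_of_norm_le_const (a := 0) (b := T) (C := B)
    (f := fun t : ℝ => ∑ i ∈ s, c i * Complex.exp (Complex.I * t * μ i)) (fun t ht => by
      rw [Set.uIoc_of_le hT.le] at ht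
      exact h t ht.1)
  rw [sub_zero, abs_of_pos hT] at h4
  linarith

theorem card_piAntidiag_le {ι : Type*} [DecidableEq ι] (s : Finset ι) (k : ℕ) :
    (s.piAntidiag k).card ≤ (k + 1) ^ s.card := by
  have h : (s.pi fun _ => Finset.range (k + 1)).card = (k + 1) ^ s.card := by
    simp [Finset.card_pi]
  rw [← h]
  refine Finset.card_le_card_of_injOn (fun n i _ => n i) ?_ ?_
  · intro n hn
    rw [Finset.mem_coe, Finset.mem_piAntidiag] at hn
    rw [Finset.mem_coe, Finset.mem_pi]
    intro i hi
    rw [Finset.mem_range, Nat.lt_succ_iff, ← hn.1]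
    exact Finset.single_le_sum (fun _ _ => Nat.zero_le _) hi
  · intro n hn m hm hnm
    rw [Finset.mem_coe, Finset.mem_piAntidiag] at hn hm
    funext i
    by_cases hi : i ∈ s
    · exact congrFun (congrFun hnm i) hi
    · have h1 : n i = 0 := by by_contra h; exact hi (hn.2 i h)
      have h2 : m i = 0 := by by_contra h; exact hi (hm.2 i h)
      rw [h1, h2]

/-- **Kronecker's approximation theorem**, in the form of Bohr: if the signs `ε j` are compatible
with all homogeneous additive relations between the frequencies `x j`, then the twisted
exponential sum comes as close to its trivial bound at positive times as desired.

The `k`-th power of the sum is expanded by the multinomial theorem. Terms of equal frequency carry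
equal signs, so they add up without cancellation, and the mean value bounds each of them by the
`k`-th power of the supremum. As there are only polynomially many terms, and their
absolute values sum to `1`, the supremum cannot be smaller than `1`. -/
theorem exists_lt_norm_sum_exp {ι : Type*} (s : Finset ι) (a x : ι → ℝ) (ε : ι → ℂ)
    (ha : ∀ i ∈ s, 0 ≤ a i) (hsum : ∑ i ∈ s, a i = 1) (hε : ∀ i, ‖ε i‖ = 1)
    (hrel : ∀ n n' : ι → ℕ, ∑ i ∈ s, n i = ∑ i ∈ s, n' i →
      ∑ i ∈ s, n i * x i = ∑ i ∈ s, n' i * x i → ∏ i ∈ s, ε i ^ n i = ∏ i ∈ s, ε i ^ n' i)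
    {ρ : ℝ} (hρ : ρ < 1) :
    ∃ t : ℝ, 0 < t ∧ ρ < ‖∑ i ∈ s, a i * ε i * Complex.exp (Complex.I * t * x i)‖ := by
  classical
  wlog h0 : 0 < ρ generalizing ρ
  · obtain ⟨t, ht, h⟩ := this (ρ := 1 / 2) (by norm_num) (by norm_num)
    exact ⟨t, ht, by linarith⟩
  by_contra! hcon
  let w : (ι → ℕ) → ℝ := fun n => Nat.multinomial s n * ∏ i ∈ s, a i ^ n i
  have hw0 : ∀ n, 0 ≤ w n := fun n =>
    mul_nonneg (Nat.cast_nonneg _) (Finset.prod_nonneg fun i hi => pow_nonneg (ha i hi) _)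
  have hwsum : ∀ k, ∑ n ∈ s.piAntidiag k, w n = 1 := fun k => by
    rw [← Finset.sum_pow_eq_sum_piAntidiag, hsum, one_pow]
  have hexp : ∀ (k : ℕ) (t : ℝ), (∑ i ∈ s, a i * ε i * Complex.exp (Complex.I * t * x i)) ^ k =
      ∑ n ∈ s.piAntidiag k, (w n * ∏ i ∈ s, ε i ^ n i) *
        Complex.exp (Complex.I * t * (∑ i ∈ s, n i * x i : ℝ)) := by
    intro k t
    rw [Finset.sum_pow_eq_sum_piAntidiag]
    refine Finset.sum_congr rfl fun n _ => ?_
    have h1 : Complex.exp (Complex.I * t * (∑ i ∈ s, n i * x i : ℝ)) =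
        ∏ i ∈ s, Complex.exp (Complex.I * t * x i) ^ n i := by
      simp_rw [← Complex.exp_nat_mul]
      rw [← Complex.exp_sum]
      congr 1
      push_cast
      rw [Finset.mul_sum]
      exact Finset.sum_congr rfl fun i _ => by ring
    rw [h1]
    simp only [w, mul_pow, Finset.prod_mul_distrib]
    push_cast
    ring
  have hbound : ∀ k, ∀ n ∈ s.piAntidiag k, w n ≤ ρ ^ k := by
    intro k n hn
    have h1 := norm_sum_freq_zero_le (s.piAntidiag k) (fun m => (w m : ℂ) * ∏ i ∈ s, ε i ^ m i)
      (fun m => ∑ i ∈ s, m i * x i - ∑ i ∈ s, n i * x i) (B := ρ ^ k) (fun t ht => by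
        have h2 : ∑ m ∈ s.piAntidiag k, (w m * ∏ i ∈ s, ε i ^ m i) *
            Complex.exp (Complex.I * t * (∑ i ∈ s, m i * x i - ∑ i ∈ s, n i * x i : ℝ)) =
            (∑ i ∈ s, a i * ε i * Complex.exp (Complex.I * t * x i)) ^ k *
              Complex.exp (((-t * ∑ i ∈ s, n i * x i : ℝ) : ℂ) * Complex.I) := by
          rw [hexp, Finset.sum_mul]
          refine Finset.sum_congr rfl fun m _ => ?_
          rw [mul_assoc ((w m : ℂ) * _), ← Complex.exp_add]
          congr 2
          push_cast
          ring
        rw [h2, norm_mul, Complex.norm_exp_ofReal_mul_I, mul_one, norm_pow]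
        exact pow_le_pow_left₀ (norm_nonneg _) (hcon t ht) k)
    refine le_trans ?_ h1
    have h3 : ∑ m ∈ s.piAntidiag k with ∑ i ∈ s, m i * x i - ∑ i ∈ s, n i * x i = 0,
        (w m : ℂ) * ∏ i ∈ s, ε i ^ m i =
        (∑ m ∈ s.piAntidiag k with ∑ i ∈ s, m i * x i - ∑ i ∈ s, n i * x i = 0, w m : ℝ) *
          ∏ i ∈ s, ε i ^ n i := by
      push_cast
      rw [Finset.sum_mul]
      refine Finset.sum_congr rfl fun m hm => ?_
      rw [Finset.mem_filter, Finset.mem_piAntidiag] at hm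
      rw [hrel m n (hm.1.1.trans (Finset.mem_piAntidiag.1 hn).1.symm) (sub_eq_zero.1 hm.2)]
    rw [h3, norm_mul, norm_prod]
    simp only [norm_pow, hε, one_pow, Finset.prod_const_one, mul_one, Complex.norm_real]
    rw [Real.norm_of_nonneg (Finset.sum_nonneg fun m _ => hw0 m)]
    exact Finset.single_le_sum (f := w) (fun m _ => hw0 m) (by simp [hn])
  have hone : ∀ k : ℕ, 1 ≤ ((k + 1 : ℕ) : ℝ) ^ s.card * ρ ^ k := by
    intro k
    calc (1 : ℝ) = ∑ n ∈ s.piAntidiag k, w n := (hwsum k).symm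
      _ ≤ (s.piAntidiag k).card • ρ ^ k := Finset.sum_le_card_nsmul _ _ _ (hbound k)
      _ ≤ _ := by
        rw [nsmul_eq_mul]
        gcongr
        exact_mod_cast card_piAntidiag_le s k
  have hlim : Tendsto (fun k : ℕ => ((k + 1 : ℕ) : ℝ) ^ s.card * ρ ^ (k + 1)) atTop (𝓝 0) :=
    (tendsto_add_atTop_iff_nat 1).2 (tendsto_pow_const_mul_const_pow_of_abs_lt_one s.card
      (by rwa [abs_of_pos h0]))
  obtain ⟨k, hk⟩ := (hlim.eventually (gt_mem_nhds h0)).exists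
  have := mul_le_mul_of_nonneg_right (hone k) h0.le
  rw [mul_assoc, ← pow_succ] at this
  linarith

end QuantumWalk

/-! ### Sedentariness from the spectral measure -/

namespace QuantumWalk

open Filter Topology

variable {V : Type*} [Fintype V] [DecidableEq V] {M : Matrix V V ℝ} {u v : V} {θ : ℝ}

theorem norm_exp_I_mul (t x : ℝ) : ‖Complex.exp (Complex.I * t * x)‖ = 1 := by
  rw [show Complex.I * (t : ℂ) * x = ((t * x : ℝ) : ℂ) * Complex.I by push_cast; ring,
    Complex.norm_exp_ofReal_mul_I]

theorem sum_mass_erase (hM : M.IsHermitian) (hθ : θ ∈ support M u) :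
    ∑ l ∈ (support M u).erase θ, mass M l u = 1 - mass M θ u := by
  rw [← sum_mass_support hM u, ← Finset.add_sum_erase _ _ hθ]
  ring

theorem U_apply_self_eq_add (hM : M.IsHermitian) (hθ : θ ∈ support M u) (t : ℝ) :
    U M t u u = mass M θ u * Complex.exp (Complex.I * t * θ) +
      ∑ l ∈ (support M u).erase θ, (mass M l u : ℂ) * Complex.exp (Complex.I * t * l) := by
  rw [U_apply_self hM, Finset.add_sum_erase _
    (fun l : ℝ => (mass M l u : ℂ) * Complex.exp (Complex.I * t * l)) hθ]

/-- If one eigenvalue carries more than half of the spectral measure, the remaining terms cannot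
cancel its contribution. -/
theorem isSedentary_of_half_lt_mass (hM : M.IsHermitian) (h : 1 / 2 < mass M θ u) :
    IsSedentary M u := by
  have hθ : θ ∈ support M u := mem_support_iff.2 (mass_pos_iff.1 (by linarith))
  refine isSedentary_iff.2 ⟨2 * mass M θ u - 1, by linarith, fun t _ => ?_⟩
  have h1 : ‖∑ l ∈ (support M u).erase θ, (mass M l u : ℂ) * Complex.exp (Complex.I * t * l)‖ ≤
      1 - mass M θ u := by
    rw [← sum_mass_erase hM hθ]
    refine norm_sum_le_of_le _ fun l _ => ?_
    rw [norm_mul, norm_exp_I_mul, mul_one, Complex.norm_real,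
      Real.norm_of_nonneg (mass_nonneg l u)]
  have h2 : ‖(mass M θ u : ℂ) * Complex.exp (Complex.I * t * θ)‖ = mass M θ u := by
    rw [norm_mul, norm_exp_I_mul, mul_one, Complex.norm_real,
      Real.norm_of_nonneg (mass_nonneg θ u)]
  rw [U_apply_self_eq_add hM hθ]
  have h3 := norm_sub_le_norm_add ((mass M θ u : ℂ) * Complex.exp (Complex.I * t * θ))
    (∑ l ∈ (support M u).erase θ, (mass M l u : ℂ) * Complex.exp (Complex.I * t * l))
  linarith

theorem norm_U_apply_self (hM : M.IsHermitian) (hθ : mass M θ u = 1 / 2) (t : ℝ) :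
    ‖U M t u u‖ = ‖(1 / 2 : ℂ) + ∑ l ∈ (support M u).erase θ,
      (mass M l u : ℂ) * Complex.exp (Complex.I * t * (l - θ : ℝ))‖ := by
  have hθ' : θ ∈ support M u := mem_support_iff.2 (mass_pos_iff.1 (by rw [hθ]; norm_num))
  rw [U_apply_self_eq_add hM hθ', hθ]
  have h : ((1 / 2 : ℝ) : ℂ) * Complex.exp (Complex.I * t * θ) +
      ∑ l ∈ (support M u).erase θ, (mass M l u : ℂ) * Complex.exp (Complex.I * t * l) =
      Complex.exp (Complex.I * t * θ) * ((1 / 2 : ℂ) + ∑ l ∈ (support M u).erase θ,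
      (mass M l u : ℂ) * Complex.exp (Complex.I * t * (l - θ : ℝ))) := by
    rw [mul_add, Finset.mul_sum]
    congr 1
    · push_cast; ring
    · refine Finset.sum_congr rfl fun l _ => ?_
      rw [mul_left_comm, ← Complex.exp_add]
      congr 2
      push_cast
      ring
  rw [h, norm_mul, norm_exp_I_mul, one_mul]

theorem prod_zpow_eq_zpow_sum {ι G : Type*} [CommGroup G] (s : Finset ι) (a : G) (m : ι → ℤ) :
    ∏ i ∈ s, a ^ m i = a ^ ∑ i ∈ s, m i := by
  classical
  induction s using Finset.induction_on with
  | empty => simp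
  | insert i s hi ih => rw [Finset.prod_insert hi, Finset.sum_insert hi, ih, zpow_add]

theorem circleExp_sum {ι : Type*} (s : Finset ι) (x : ι → ℝ) :
    Circle.exp (∑ i ∈ s, x i) = ∏ i ∈ s, Circle.exp (x i) := by
  classical
  induction s using Finset.induction_on with
  | empty => simp
  | insert i s hi ih => rw [Finset.prod_insert hi, Finset.sum_insert hi, Circle.exp_add, ih]

/-- With mass `1 / 2` at `θ`, an odd relation keeps the phases `exp (i t (l - θ))` in a closed
subgroup of the torus which misses the point `(-1, …, -1)`, the only zero of the limiting
amplitude; compactness gives a positive lower bound. -/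
theorem isSedentary_of_odd_relation (hM : M.IsHermitian) (hθ : mass M θ u = 1 / 2)
    (m : ℝ → ℤ) (hm : ∑ l ∈ (support M u).erase θ, (m l : ℝ) * (l - θ) = 0)
    (hodd : Odd (∑ l ∈ (support M u).erase θ, m l)) : IsSedentary M u := by
  set P := (support M u).erase θ with hP
  have hθ' : θ ∈ support M u := mem_support_iff.2 (mass_pos_iff.1 (by rw [hθ]; norm_num))
  have hsum : ∑ l ∈ P, mass M l u = 1 / 2 := by
    rw [hP, sum_mass_erase hM hθ', hθ]; norm_num
  let K : Set (P → Circle) := {z | ∏ l, z l ^ m l = 1}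
  have hK : IsClosed K := isClosed_eq (by fun_prop) continuous_const
  let g : (P → Circle) → ℝ := fun z => ‖(1 / 2 : ℂ) + ∑ l : P, (mass M l u : ℂ) * (z l : ℂ)‖
  have hg : Continuous g := by fun_prop
  obtain ⟨z, hzK, hz⟩ := hK.isCompact.exists_isMinOn ⟨1, by simp [K]⟩ hg.continuousOn
  refine isSedentary_iff.2 ⟨g z, ?_, fun t _ => ?_⟩
  · refine lt_of_le_of_ne (norm_nonneg _) fun h0 => ?_
    have h1 : (1 / 2 : ℂ) + ∑ l : P, (mass M l u : ℂ) * (z l : ℂ) = 0 := norm_eq_zero.1 h0.symm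
    have h2 := congrArg Complex.re h1
    simp only [Complex.add_re, Complex.re_sum, Complex.re_ofReal_mul, Complex.zero_re] at h2
    have h3 : ∑ l : P, mass M l u * (1 + (z l : ℂ).re) = 0 := by
      simp only [mul_add, mul_one, Finset.sum_add_distrib]
      rw [Finset.sum_coe_sort P (fun l => mass M l u), hsum]
      simpa using h2
    have hre : ∀ l, 0 ≤ 1 + (z l : ℂ).re := fun l => by
      have := Complex.abs_re_le_norm (z l : ℂ)
      rw [Circle.norm_coe] at this
      linarith [neg_le_of_abs_le this]
    have hneg : ∀ l : P, (z l : ℂ) = -1 := by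
      intro l
      have h4 := (Finset.sum_eq_zero_iff_of_nonneg
        (fun l _ => mul_nonneg (mass_nonneg _ _) (hre l))).1 h3 l (Finset.mem_univ _)
      have h5 : 0 < mass M l u :=
        mass_pos_iff.2 (mem_support_iff.1 (Finset.mem_of_mem_erase l.2))
      have h6 : (z l : ℂ).re = -1 := by
        rcases mul_eq_zero.1 h4 with h | h
        · exact absurd h h5.ne'
        · linarith
      have h7 := Complex.sq_norm_sub_sq_re (z l : ℂ)
      rw [Circle.norm_coe, h6] at h7
      have h8 : (z l : ℂ).im = 0 := by
        have : (z l : ℂ).im ^ 2 = 0 := by linarith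
        exact pow_eq_zero_iff (two_ne_zero) |>.1 this
      exact Complex.ext (by simp [h6]) (by simp [h8])
    have hneg' : ∀ l : P, z l = -1 := fun l => Circle.ext (by rw [hneg, Circle.coe_neg]; rfl)
    have h9 : ∏ l : P, z l ^ m l = 1 := hzK
    simp only [hneg'] at h9
    rw [prod_zpow_eq_zpow_sum, Finset.sum_coe_sort P m] at h9
    have h10 := congrArg (fun w : Circle => (w : ℂ)) h9
    simp only [Circle.coe_neg, Circle.coe_one, hodd.neg_one_zpow] at h10
    norm_num at h10
  · rw [norm_U_apply_self hM hθ]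
    have hmem : (fun l : P => Circle.exp (t * ((l : ℝ) - θ))) ∈ K := by
      show ∏ l : P, Circle.exp (t * ((l : ℝ) - θ)) ^ m l = 1
      simp only [← Circle.exp_zsmul]
      rw [← circleExp_sum]
      have : ∑ l : P, m l • (t * ((l : ℝ) - θ)) = t * ∑ l ∈ P, (m l : ℝ) * (l - θ) := by
        rw [Finset.mul_sum, ← Finset.sum_coe_sort P]
        exact Finset.sum_congr rfl fun l _ => by rw [zsmul_eq_mul]; ring
      rw [this, hm, mul_zero, Circle.exp_zero]
    have h := hz hmem
    refine le_of_le_of_eq h ?_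
    simp only [g]
    congr 2
    rw [← Finset.sum_coe_sort P]
    refine Finset.sum_congr rfl fun l _ => ?_
    rw [Circle.coe_exp]
    congr 2
    push_cast
    ring

theorem exists_odd_relation_of_isSedentary (hM : M.IsHermitian) (hθ : mass M θ u = 1 / 2)
    (hs : IsSedentary M u) :
    ∃ m : ℝ → ℤ, ∑ l ∈ (support M u).erase θ, (m l : ℝ) * (l - θ) = 0 ∧
      Odd (∑ l ∈ (support M u).erase θ, m l) := by
  classical
  by_contra! hcon
  have hθ' : θ ∈ support M u := mem_support_iff.2 (mass_pos_iff.1 (by rw [hθ]; norm_num))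
  set P := (support M u).erase θ with hP
  obtain ⟨C, hC, hs⟩ := isSedentary_iff.1 hs
  let ε : ℝ → ℂ := fun l => if l = θ then 1 else -1
  have hεP : ∀ l ∈ P, ε l = -1 := fun l hl => if_neg (Finset.ne_of_mem_erase hl)
  have hrel : ∀ n n' : ℝ → ℕ, ∑ l ∈ support M u, n l = ∑ l ∈ support M u, n' l →
      ∑ l ∈ support M u, n l * l = ∑ l ∈ support M u, n' l * l →
      ∏ l ∈ support M u, ε l ^ n l = ∏ l ∈ support M u, ε l ^ n' l := by
    intro n n' h1 h2
    have hprod : ∀ k : ℝ → ℕ, ∏ l ∈ support M u, ε l ^ k l = (-1) ^ ∑ l ∈ P, k l := by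
      intro k
      rw [← Finset.mul_prod_erase _ _ hθ', ← Finset.prod_pow_eq_pow_sum]
      simp only [ε, if_true, one_pow, one_mul]
      exact Finset.prod_congr rfl fun l hl => by rw [if_neg (Finset.ne_of_mem_erase hl)]
    have hsplit : ∀ k : ℝ → ℕ, ∑ l ∈ P, (k l : ℝ) * (l - θ) =
        ∑ l ∈ support M u, (k l : ℝ) * l - (∑ l ∈ support M u, (k l : ℝ)) * θ := by
      intro k
      rw [Finset.sum_mul, ← Finset.sum_sub_distrib, ← Finset.add_sum_erase _ _ hθ', sub_self,
        zero_add]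
      exact Finset.sum_congr rfl fun l _ => by ring
    have h3 := hcon (fun l => (n l : ℤ) - n' l) (by
      have h4 : ∑ l ∈ support M u, (n l : ℝ) = ∑ l ∈ support M u, (n' l : ℝ) := by
        exact_mod_cast h1
      have h5 := hsplit n
      rw [h2, h4, ← hsplit n'] at h5
      push_cast
      simp only [sub_mul, Finset.sum_sub_distrib] at h5 ⊢
      linarith)
    rw [Int.not_odd_iff_even, Finset.sum_sub_distrib, Int.even_sub] at h3
    have h4 : Even (∑ l ∈ P, n l) ↔ Even (∑ l ∈ P, n' l) := by
      rw [← Int.even_coe_nat, ← Int.even_coe_nat]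
      push_cast
      exact h3
    rw [hprod, hprod]
    by_cases h5 : Even (∑ l ∈ P, n l)
    · rw [h5.neg_one_pow, (h4.1 h5).neg_one_pow]
    · rw [(Nat.not_even_iff_odd.1 h5).neg_one_pow,
        (Nat.not_even_iff_odd.1 (fun h => h5 (h4.2 h))).neg_one_pow]
  have hC1 : C ≤ 1 := by
    have h := hs 1 one_pos
    rw [U_apply_self hM] at h
    refine h.trans ?_
    rw [← sum_mass_support hM u]
    refine norm_sum_le_of_le _ fun l _ => ?_
    rw [norm_mul, norm_exp_I_mul, mul_one, Complex.norm_real,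
      Real.norm_of_nonneg (mass_nonneg l u)]
  -- The parallelogram law turns closeness of `1 / 2 - w` to norm `1` into smallness of `1 / 2 + w`.
  obtain ⟨t, ht, h⟩ := exists_lt_norm_sum_exp (support M u) (fun l => mass M l u) id ε
    (fun l _ => mass_nonneg l u) (sum_mass_support hM u)
    (fun l => by simp only [ε]; split_ifs <;> simp) hrel (ρ := 1 - C ^ 2 / 2)
    (by have := pow_pos hC 2; linarith)
  set w : ℂ := ∑ l ∈ P, (mass M l u : ℂ) * Complex.exp (Complex.I * t * l) with hw
  set z : ℂ := (mass M θ u : ℂ) * Complex.exp (Complex.I * t * θ) with hz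
  have hz1 : ‖z‖ = 1 / 2 := by
    rw [hz, norm_mul, norm_exp_I_mul, mul_one, Complex.norm_real, hθ]
    norm_num
  have hw1 : ‖w‖ ≤ 1 / 2 := by
    have : ∑ l ∈ P, mass M l u = 1 / 2 := by rw [hP, sum_mass_erase hM hθ', hθ]; norm_num
    rw [← this]
    refine norm_sum_le_of_le _ fun l _ => ?_
    rw [norm_mul, norm_exp_I_mul, mul_one, Complex.norm_real,
      Real.norm_of_nonneg (mass_nonneg l u)]
  have hsub : ∑ l ∈ support M u, (mass M l u : ℂ) * ε l * Complex.exp (Complex.I * t * (id l : ℝ)) =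
      z - w := by
    rw [← Finset.add_sum_erase _ _ hθ', sub_eq_add_neg, hw, ← Finset.sum_neg_distrib]
    congr 1
    · simp [ε, hz]
    · refine Finset.sum_congr rfl fun l hl => ?_
      rw [hεP l hl, id]
      ring
  rw [hsub] at h
  have hU := hs t ht
  rw [U_apply_self_eq_add hM hθ'] at hU
  change C ≤ ‖z + w‖ at hU
  have hpar := parallelogram_law_with_norm ℝ z w
  have hC2 : C ^ 2 ≤ 1 := pow_le_one₀ hC.le hC1
  have h6 : C ^ 2 ≤ ‖z + w‖ ^ 2 := pow_le_pow_left₀ hC.le hU 2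
  have h7 : (1 - C ^ 2 / 2) ^ 2 ≤ ‖z - w‖ ^ 2 := pow_le_pow_left₀ (by linarith) h.le 2
  have h8 : ‖w‖ ^ 2 ≤ (1 / 2) ^ 2 := pow_le_pow_left₀ (norm_nonneg _) hw1 2
  rw [hz1] at hpar
  have h9 : 0 < C ^ 4 := pow_pos hC 4
  linarith

end QuantumWalk

/-! ### Periodic vertices -/

namespace QuantumWalk

open Filter Topology

variable {V : Type*} [Fintype V] [DecidableEq V] {M : Matrix V V ℝ} {u v : V} {θ : ℝ}

/-- At a period all phases agree: equality holds in the triangle inequality for the convex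
combination `U M τ u u` of the phases. -/
theorem exp_eq_of_norm_U_eq_one (hM : M.IsHermitian) {τ : ℝ} (hτ : ‖U M τ u u‖ = 1) {l : ℝ}
    (hl : l ∈ support M u) : Complex.exp (Complex.I * τ * l) = U M τ u u := by
  set z := U M τ u u with hz
  set e : ℝ → ℂ := fun l => Complex.exp (Complex.I * τ * l) * (starRingEnd ℂ) z with he
  have hnorm : ∀ l, ‖e l‖ = 1 := fun l => by
    rw [he, norm_mul, norm_exp_I_mul, RCLike.norm_conj, hτ, one_mul]
  have hzz : z * (starRingEnd ℂ) z = 1 := by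
    rw [Complex.mul_conj, Complex.normSq_eq_norm_sq, hτ]; norm_num
  have h1 : ∑ l ∈ support M u, (mass M l u : ℂ) * e l = 1 := by
    have hzU := U_apply_self hM τ u
    rw [← hz] at hzU
    rw [← hzz]
    conv_rhs => enter [1]; rw [hzU]
    rw [Finset.sum_mul]
    exact Finset.sum_congr rfl fun l _ => by rw [he]; ring
  have h2 : ∑ l ∈ support M u, mass M l u * (1 - (e l).re) = 0 := by
    have := congrArg Complex.re h1
    simp only [Complex.re_sum, Complex.re_ofReal_mul, Complex.one_re] at this
    simp only [mul_sub, mul_one, Finset.sum_sub_distrib, sum_mass_support hM, this, sub_self]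
  have hre : ∀ l, 0 ≤ 1 - (e l).re := fun l => by
    have := Complex.re_le_norm (e l)
    rw [hnorm] at this
    linarith
  have h3 := (Finset.sum_eq_zero_iff_of_nonneg
    (fun l _ => mul_nonneg (mass_nonneg l u) (hre l))).1 h2 l hl
  have h4 : (e l).re = 1 := by
    rcases mul_eq_zero.1 h3 with h | h
    · exact absurd h (mass_pos_iff.2 (mem_support_iff.1 hl)).ne'
    · linarith
  have h5 := Complex.sq_norm_sub_sq_re (e l)
  rw [hnorm, h4] at h5
  have h6 : (e l).im = 0 := pow_eq_zero_iff (two_ne_zero) |>.1 (by linarith : (e l).im ^ 2 = 0)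
  have h7 : e l = 1 := Complex.ext (by simp [h4]) (by simp [h6])
  have hz0 : (starRingEnd ℂ) z ≠ 0 := right_ne_zero_of_mul_eq_one hzz
  exact mul_right_cancel₀ hz0 (h7.trans hzz.symm)

/-- Periodicity puts the support into an arithmetic progression through any of its elements. -/
theorem exists_arith_prog_of_isPeriodic (hM : M.IsHermitian) (h : IsPeriodic M u)
    (hθ : θ ∈ support M u) :
    ∃ c : ℝ, 0 < c ∧ ∃ b : ℝ → ℤ, ∀ l ∈ support M u, l = θ + b l * c := by
  obtain ⟨τ, hτ, h⟩ := h
  refine ⟨2 * Real.pi / τ, by positivity, ?_⟩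
  have key : ∀ l ∈ support M u, ∃ n : ℤ, l = θ + n * (2 * Real.pi / τ) := by
    intro l hl
    have h1 := (exp_eq_of_norm_U_eq_one hM h hl).trans (exp_eq_of_norm_U_eq_one hM h hθ).symm
    obtain ⟨n, hn⟩ := Complex.exp_eq_exp_iff_exists_int.1 h1
    refine ⟨n, ?_⟩
    have h2 : Complex.I * ((τ * l : ℝ) : ℂ) =
        Complex.I * ((τ * θ + n * (2 * Real.pi) : ℝ) : ℂ) := by
      push_cast
      linear_combination hn
    have h3 : τ * l = τ * θ + n * (2 * Real.pi) := by
      exact_mod_cast mul_left_cancel₀ Complex.I_ne_zero h2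
    field_simp
    linarith
  choose! b hb using key
  exact ⟨b, hb⟩

/-- The return amplitude of a periodic vertex is periodic in absolute value, hence attains its
infimum. -/
theorem IsPeriodic.isTightlySedentary (hM : M.IsHermitian) (h : IsPeriodic M u)
    (hs : IsSedentary M u) : IsTightlySedentary M u := by
  obtain ⟨τ, hτ, h⟩ := h
  have hper : Function.Periodic (fun t : ℝ => ‖U M t u u‖) τ := by
    intro t
    have h1 : U M (t + τ) u u = U M t u u * U M τ u u := by
      rw [U_apply_self hM (t + τ), U_apply_self hM t, Finset.sum_mul]
      refine Finset.sum_congr rfl fun l hl => ?_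
      rw [← exp_eq_of_norm_U_eq_one hM h hl, mul_assoc (mass M l u : ℂ), ← Complex.exp_add]
      congr 2
      push_cast
      ring
    simp only [h1, norm_mul, h, mul_one]
  have hcont : Continuous fun t : ℝ => ‖U M t u u‖ := by
    simp only [U_apply_self hM]
    fun_prop
  obtain ⟨t₀, ht₀, hmin⟩ := (isCompact_Icc (a := τ) (b := τ + τ)).exists_isMinOn
    ⟨τ, by simp [hτ.le]⟩ hcont.continuousOn
  have ht₀' : 0 < t₀ := hτ.trans_le ht₀.1
  have hle : ∀ t, ‖U M t₀ u u‖ ≤ ‖U M t u u‖ := by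
    intro t
    obtain ⟨s, hs, hst⟩ := hper.exists_mem_Ico hτ t τ
    rw [hst]
    exact hmin ⟨hs.1, hs.2.le⟩
  have : Nonempty (Set.Ioi (0 : ℝ)) := ⟨⟨1, one_pos (α := ℝ)⟩⟩
  have hb : BddBelow (Set.range fun t : Set.Ioi (0 : ℝ) => ‖U M t u u‖) :=
    ⟨0, by rintro _ ⟨t, rfl⟩; exact norm_nonneg _⟩
  have hinf : ‖U M t₀ u u‖ = ⨅ t : Set.Ioi (0 : ℝ), ‖U M t u u‖ :=
    le_antisymm (le_ciInf fun t => hle t) (ciInf_le hb ⟨t₀, ht₀'⟩)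
  obtain ⟨C, hC, hs⟩ := isSedentary_iff.1 hs
  exact ⟨‖U M t₀ u u‖, ⟨hC.trans_le (hs t₀ ht₀'), (hle τ).trans h.le, hinf.le⟩, hinf, t₀, ht₀', rfl⟩

/-! ### Odd relations between integers -/

theorem exists_odd_mul_two_pow {b : ℤ} (hb : b ≠ 0) :
    ∃ o : ℤ, Odd o ∧ b = 2 ^ padicValInt 2 b * o := by
  obtain ⟨o, ho⟩ := padicValInt_dvd (p := 2) b
  refine ⟨o, ?_, by exact_mod_cast ho⟩
  rw [← Int.not_even_iff_odd]
  rintro ⟨k, rfl⟩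
  have h : ((2 : ℕ) : ℤ) ^ (padicValInt 2 b + 1) ∣ b :=
    ⟨k, by rw [pow_succ]; push_cast at ho ⊢; linarith⟩
  rw [padicValInt_dvd_iff] at h
  rcases h with h | h
  · exact hb h
  · omega

/-- An integer relation with odd coefficient sum exists between nonzero integers if and only if
their `2`-adic valuations are not all equal. -/
theorem exists_odd_relation_iff {ι : Type*} [DecidableEq ι] (P : Finset ι) (b : ι → ℤ)
    (hb : ∀ l ∈ P, b l ≠ 0) :
    (∃ m : ι → ℤ, ∑ l ∈ P, m l * b l = 0 ∧ Odd (∑ l ∈ P, m l)) ↔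
      ¬ ∀ l ∈ P, ∀ k ∈ P, padicValInt 2 (b l) = padicValInt 2 (b k) := by
  constructor
  · rintro ⟨m, hm, hodd⟩ hall
    rcases P.eq_empty_or_nonempty with rfl | ⟨l₀, hl₀⟩
    · simp at hodd
    have h1 : ∀ l ∈ P, ∃ o : ℤ, Odd o ∧ b l = 2 ^ padicValInt 2 (b l₀) * o := fun l hl => by
      rw [hall l₀ hl₀ l hl]
      exact exists_odd_mul_two_pow (hb l hl)
    choose! o ho hbo using h1
    have h2 : ∑ l ∈ P, m l * o l = 0 := by
      have h3 : (2 : ℤ) ^ padicValInt 2 (b l₀) * ∑ l ∈ P, m l * o l = 0 := by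
        rw [← hm, Finset.mul_sum]
        refine Finset.sum_congr rfl fun l hl => ?_
        conv_rhs => rw [hbo l hl]
        ring
      exact (mul_eq_zero.1 h3).resolve_left (by positivity)
    have h4 : Even (∑ l ∈ P, (m l * o l - m l)) := by
      refine Finset.even_sum _ fun l hl => ?_
      obtain ⟨k, hk⟩ := ho l hl
      exact ⟨m l * k, by rw [hk]; ring⟩
    rw [Finset.sum_sub_distrib, h2, zero_sub, even_neg] at h4
    exact (Int.not_even_iff_odd.2 hodd) h4
  · intro h
    push Not at h
    obtain ⟨l, hl, k, hk, hne⟩ := h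
    wlog hlt : padicValInt 2 (b l) < padicValInt 2 (b k) generalizing l k
    · exact this k hk l hl hne.symm (by omega)
    obtain ⟨o, ho, hbl⟩ := exists_odd_mul_two_pow (hb l hl)
    obtain ⟨p, -, hbk⟩ := exists_odd_mul_two_pow (hb k hk)
    obtain ⟨d, hd⟩ := Nat.exists_eq_add_of_lt hlt
    set α := padicValInt 2 (b l)
    rw [hd] at hbk
    have hlk : l ≠ k := by rintro rfl; exact hne rfl
    -- The relation `2 ^ (β - α) p * b l - o * b k = 0` between `b l = 2 ^ α o` and `b k = 2 ^ β p`.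
    refine ⟨fun i => if i = l then 2 ^ (d + 1) * p else if i = k then -o else 0, ?_, ?_⟩
    · rw [Finset.sum_eq_add_of_mem l k hl hk hlk]
      · simp only [if_true, if_neg hlk.symm]
        rw [hbl, hbk]
        ring
      · rintro i - ⟨h1, h2⟩
        simp [h1, h2]
    · rw [Finset.sum_eq_add_of_mem l k hl hk hlk]
      · simp only [if_true, if_neg hlk.symm]
        refine Even.add_odd ?_ ho.neg
        exact ⟨2 ^ d * p, by ring⟩
      · rintro i - ⟨h1, h2⟩
        simp [h1, h2]

theorem hasOddRelation_iff_of_eq_add_mul {c : ℝ} (hc : c ≠ 0) {b : ℝ → ℤ}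
    (hθ : θ ∉ plusSupport M u v) (hb : ∀ l ∈ plusSupport M u v, l = θ + b l * c) :
    HasOddRelation M θ u v ↔
      ¬ ∀ l ∈ plusSupport M u v, ∀ k ∈ plusSupport M u v,
        padicValInt 2 (b l) = padicValInt 2 (b k) := by
  rw [← exists_odd_relation_iff]
  · refine exists_congr fun m => and_congr_left fun _ => ?_
    have h : ∑ l ∈ plusSupport M u v, (m l : ℝ) * (l - θ) =
        ((∑ l ∈ plusSupport M u v, m l * b l : ℤ) : ℝ) * c := by
      push_cast
      rw [Finset.sum_mul]
      refine Finset.sum_congr rfl fun l hl => ?_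
      nth_rw 2 [hb l hl]
      ring
    rw [h, mul_eq_zero, or_iff_left hc, Int.cast_eq_zero]
  · intro l hl h0
    have := hb l hl
    rw [h0, Int.cast_zero, zero_mul, add_zero] at this
    exact hθ (this ▸ hl)

theorem TwoAdicForm.hasOddRelation {c : ℝ} (hc : c ≠ 0) (hθ : θ ∉ plusSupport M u v)
    (h : TwoAdicForm M θ c u v) : HasOddRelation M θ u v := by
  obtain ⟨b, hb, hne⟩ := h
  exact (hasOddRelation_iff_of_eq_add_mul hc hθ hb).2 hne

theorem HasOddRelation.twoAdicForm {c : ℝ} (hc : c ≠ 0) (hθ : θ ∉ plusSupport M u v)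
    (hb : ∀ l ∈ plusSupport M u v, ∃ b : ℤ, l = θ + b * c) (h : HasOddRelation M θ u v) :
    TwoAdicForm M θ c u v := by
  choose! b hb using hb
  exact ⟨b, hb, (hasOddRelation_iff_of_eq_add_mul hc hθ hb).1 h⟩

end QuantumWalk

/-! ### Conjugate eigenvalues -/

namespace QuantumWalk

open Polynomial

/-- The roots of a polynomial which splits in `L` lie in a Galois extension of `F` inside `L`. -/
theorem exists_isGalois_of_splits {F L : Type*} [Field F] [CharZero F] [Field L] [Algebra F L]
    {p : F[X]} (hp : p ≠ 0) (hs : (p.map (algebraMap F L)).Splits) :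
    ∃ K : IntermediateField F L, IsGalois F K ∧ FiniteDimensional F K ∧
      ∀ x : L, aeval x p = 0 → x ∈ K := by
  have h := IntermediateField.adjoin_rootSet_isSplittingField hs
  refine ⟨IntermediateField.adjoin F (p.rootSet L), ?_, ?_, ?_⟩
  · have := Normal.of_isSplittingField (F := F) (E := IntermediateField.adjoin F (p.rootSet L)) p
    exact ⟨⟩
  · exact IsSplittingField.finiteDimensional _ p
  · intro x hx
    exact IntermediateField.subset_adjoin _ _ ((mem_rootSet_of_ne hp).2 hx)

theorem isConjRoot_coe_algEquiv {F L : Type*} [Field F] [Field L] [Algebra F L]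
    {K : IntermediateField F L} (σ : K ≃ₐ[F] K) (x : K) : IsConjRoot F (x : L) (σ x : L) :=
  (isConjRoot_algHom_iff K.val).2 (isConjRoot_of_algEquiv x σ)

/-- A power sum over a finite set which is closed under conjugation lies in the base field. -/
theorem sum_pow_mem_range_algebraMap {F L : Type*} [Field F] [Field L] [Algebra F L]
    (K : IntermediateField F L) [IsGalois F K] [FiniteDimensional F K]
    (S : Finset L) (hK : ∀ x ∈ S, x ∈ K)
    (hS : ∀ x ∈ S, ∀ y : L, IsConjRoot F x y → y ∈ S) (k : ℕ) :
    ∃ r : F, algebraMap F L r = ∑ x ∈ S, x ^ k := by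
  let y : K := ∑ x ∈ S.attach, ⟨x, hK x x.2⟩ ^ k
  have hy : (y : L) = ∑ x ∈ S, x ^ k := by
    simp only [y]
    rw [← Finset.sum_attach S]
    push_cast
    rfl
  have hfix : ∀ σ : K ≃ₐ[F] K, σ y = y := by
    intro σ
    simp only [y, map_sum, map_pow]
    let f : S → S := fun x => ⟨σ ⟨x, hK x x.2⟩,
      hS x x.2 _ (isConjRoot_coe_algEquiv σ ⟨x, hK x x.2⟩)⟩
    have hf : Function.Injective f := by
      intro a b hab
      have h1 : ((f a : S) : L) = (f b : S) := by rw [hab]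
      have h2 : (⟨a, hK a a.2⟩ : K) = ⟨b, hK b b.2⟩ := σ.injective (Subtype.ext h1)
      exact Subtype.ext (Subtype.mk.inj h2)
    have hbij := Finite.injective_iff_bijective.1 hf
    have h3 := hbij.sum_comp (fun x : S => (⟨x, hK x x.2⟩ : K) ^ k)
    rw [Finset.univ_eq_attach] at h3
    exact h3
  obtain ⟨r, hr⟩ := (IsGalois.mem_range_algebraMap_iff_fixed y).2 hfix
  refine ⟨r, ?_⟩
  rw [← hy, ← hr]
  rfl

theorem exists_int_of_sq_eq {q : ℚ} {Δ s : ℕ} (hΔ : Squarefree Δ) (h : q ^ 2 * Δ = s) :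
    ∃ n : ℤ, q = n := by
  have h1 : q.num ^ 2 * Δ = s * (q.den : ℤ) ^ 2 := by
    have hd : (q.den : ℚ) ≠ 0 := by exact_mod_cast q.den_nz
    rw [← Rat.num_div_den q] at h
    field_simp at h
    rw [mul_comm (s : ℤ)]
    exact_mod_cast h
  have h2 : (q.den : ℤ) ^ 2 ∣ q.num ^ 2 * Δ := ⟨s, by rw [h1, mul_comm]⟩
  have h3 : IsCoprime ((q.den : ℤ) ^ 2) (q.num ^ 2) := by
    apply IsCoprime.pow
    rw [Int.isCoprime_iff_gcd_eq_one, Int.gcd_comm]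
    exact q.reduced
  have h4 : q.den * q.den ∣ Δ := by
    have := h3.dvd_of_dvd_mul_left h2
    rw [sq] at this
    exact_mod_cast this
  have h5 : q.den = 1 := Nat.isUnit_iff.1 (hΔ _ h4)
  exact ⟨q.num, ((Rat.den_eq_one_iff q).1 h5).symm⟩

variable {V : Type*} [Fintype V] [DecidableEq V] {M : Matrix V V ℝ} {u v : V} {θ : ℝ}

theorem isRoot_charpoly_of_mem_support {l : ℝ} (hl : l ∈ support M u) : M.charpoly.IsRoot l := by
  have h := (Finset.mem_filter.1 hl).1
  rw [eigenvalues, Multiset.mem_toFinset] at h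
  exact isRoot_of_mem_roots h

/-- If the characteristic polynomial is integral and the support of a periodic vertex is closed
under conjugation, then the common difference `c` of the support satisfies `c ^ 2 ∈ ℚ`, because
`c ^ 2` times a positive integer is the conjugation invariant sum of all `(l - l') ^ 2`. -/
theorem exists_rat_eq_sq {p : ℤ[X]} (hM : M.IsHermitian)
    (hp : p.map (Int.castRingHom ℝ) = M.charpoly) (hcl : SupportConjClosed M u) {c : ℝ}
    {b : ℝ → ℤ} (hb : ∀ l ∈ support M u, l = θ + b l * c) (hθ : θ ∈ support M u)
    {l₀ : ℝ} (hl₀ : l₀ ∈ support M u) (hne : l₀ ≠ θ) : ∃ r : ℚ, (r : ℝ) = c ^ 2 := by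
  have hpmap : (p.map (Int.castRingHom ℚ)).map (algebraMap ℚ ℝ) = M.charpoly := by
    rw [Polynomial.map_map, ← hp]
    congr 1
  have hp0 : p.map (Int.castRingHom ℚ) ≠ 0 := by
    intro h
    rw [h, Polynomial.map_zero] at hpmap
    exact (Matrix.charpoly_monic M).ne_zero hpmap.symm
  obtain ⟨K, hK1, hK2, hK⟩ := exists_isGalois_of_splits hp0 (by
    rw [hpmap]; exact hM.splits_charpoly)
  have hSK : ∀ x ∈ support M u, x ∈ K := fun x hx => hK x (by
    rw [← Polynomial.eval_map_algebraMap, hpmap]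
    exact isRoot_charpoly_of_mem_support hx)
  obtain ⟨r₁, hr₁⟩ := sum_pow_mem_range_algebraMap K (support M u) hSK hcl 1
  obtain ⟨r₂, hr₂⟩ := sum_pow_mem_range_algebraMap K (support M u) hSK hcl 2
  set S := support M u with hS
  set N : ℤ := ∑ x ∈ S, ∑ y ∈ S, (b x - b y) ^ 2 with hN
  have h1 : ∑ x ∈ S, ∑ y ∈ S, (x - y) ^ 2 = 2 * S.card * r₂ - 2 * (r₁ : ℝ) ^ 2 := by
    simp only [eq_ratCast, pow_one] at hr₁ hr₂
    have h3 : ∑ x ∈ S, ∑ y ∈ S, 2 * x * y = 2 * (r₁ : ℝ) ^ 2 := by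
      rw [sq, hr₁, Finset.sum_mul_sum, Finset.mul_sum]
      refine Finset.sum_congr rfl fun x _ => ?_
      rw [Finset.mul_sum]
      exact Finset.sum_congr rfl fun y _ => by ring
    simp only [sub_sq, Finset.sum_add_distrib, Finset.sum_sub_distrib, h3, Finset.sum_const,
      nsmul_eq_mul, hr₂, ← Finset.mul_sum]
    ring
  have h2 : ∑ x ∈ S, ∑ y ∈ S, (x - y) ^ 2 = N * c ^ 2 := by
    rw [hN]
    push_cast
    simp only [Finset.sum_mul]
    refine Finset.sum_congr rfl fun x hx => Finset.sum_congr rfl fun y hy => ?_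
    conv_lhs => rw [hb x hx, hb y hy]
    ring
  have hNpos : 0 < N := by
    refine Finset.sum_pos' (fun x _ => Finset.sum_nonneg fun y _ => sq_nonneg _)
      ⟨l₀, hl₀, Finset.sum_pos' (fun y _ => sq_nonneg _) ⟨θ, hθ, ?_⟩⟩
    refine sq_pos_iff.2 (sub_ne_zero.2 fun h => hne ?_)
    rw [hb l₀ hl₀, h]
    exact (hb θ hθ).symm
  refine ⟨(2 * S.card * r₂ - 2 * r₁ ^ 2) / N, ?_⟩
  have hN' : (N : ℝ) ≠ 0 := by exact_mod_cast hNpos.ne'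
  push_cast
  rw [← h1, h2]
  field_simp

/-- For a periodic vertex with conjugation closed support and integral characteristic polynomial
all differences in the support are integer multiples of the square root of one square-free
integer. -/
theorem exists_squarefree_of_isPeriodic (hM : M.IsHermitian) (hint : HasIntegralCharpoly M)
    (hcl : SupportConjClosed M u) (hper : IsPeriodic M u) (hθ : θ ∈ support M u) :
    ∃ Δ : ℕ, Squarefree Δ ∧ ∀ l ∈ support M u, ∃ b : ℤ, l = θ + b * Real.sqrt Δ := by
  obtain ⟨c, hc, b, hb⟩ := exists_arith_prog_of_isPeriodic hM hper hθ
  by_cases hall : ∀ l ∈ support M u, l = θ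
  · exact ⟨1, squarefree_one, fun l hl => ⟨0, by simp [hall l hl]⟩⟩
  push Not at hall
  obtain ⟨l₀, hl₀, hne⟩ := hall
  obtain ⟨p, hp⟩ := hint
  obtain ⟨r, hr⟩ := exists_rat_eq_sq hM hp hcl hb hθ hl₀ hne
  have hpm : p.Monic := by
    have h := Matrix.charpoly_monic M
    rw [← hp] at h
    exact Polynomial.monic_of_injective (RingHom.injective_int _) h
  have hintegral : ∀ l ∈ support M u, IsIntegral ℤ l := fun l hl =>
    ⟨p, hpm, by
      have := isRoot_charpoly_of_mem_support hl
      rw [← hp, IsRoot.def, eval_map] at this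
      exact this⟩
  have hsq : ∀ l ∈ support M u, ∃ s : ℕ, (l - θ) ^ 2 = s := by
    intro l hl
    have h1 : IsIntegral ℤ ((((b l : ℚ) ^ 2 * r : ℚ)) : ℝ) := by
      have h2 : (((b l : ℚ) ^ 2 * r : ℚ) : ℝ) = (l - θ) ^ 2 := by
        push_cast
        rw [hr]
        nth_rw 2 [hb l hl]
        ring
      rw [h2]
      exact ((hintegral l hl).sub (hintegral θ hθ)).pow 2
    have h3 : IsIntegral ℤ ((b l : ℚ) ^ 2 * r) :=
      (isIntegral_algHom_iff (Algebra.algHom ℤ ℚ ℝ) (Rat.cast_injective)).1 h1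
    obtain ⟨n, hn⟩ := IsIntegrallyClosed.isIntegral_iff.1 h3
    have h4 : (l - θ) ^ 2 = n := by
      have h5 := congrArg (fun x : ℚ => (x : ℝ)) hn
      simp only [algebraMap_int_eq, eq_intCast] at h5
      push_cast at h5
      rw [h5, hr]
      nth_rw 1 [hb l hl]
      ring
    have h6 : 0 ≤ n := by
      have := sq_nonneg (l - θ)
      rw [h4] at this
      exact_mod_cast this
    lift n to ℕ using h6
    exact ⟨n, by exact_mod_cast h4⟩
  obtain ⟨D, hD⟩ := hsq l₀ hl₀
  obtain ⟨Δ, s, hΔ, hsf⟩ := Nat.sq_mul_squarefree D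
  refine ⟨Δ, hsf, fun l hl => ?_⟩
  have hΔ0 : (0 : ℝ) < Δ := by exact_mod_cast Nat.pos_of_ne_zero hsf.ne_zero
  have hdiff : l₀ - θ ≠ 0 := sub_ne_zero.2 hne
  have hb0 : (b l₀ : ℝ) ≠ 0 := by
    intro h0
    apply hne
    have := hb l₀ hl₀
    rwa [h0, zero_mul, add_zero] at this
  have hD2 : (l₀ - θ) ^ 2 = (s * Real.sqrt Δ) ^ 2 := by
    rw [hD, mul_pow, Real.sq_sqrt hΔ0.le, ← hΔ]
    push_cast
    ring
  -- The quotient `q` of `l - θ` by `√Δ` is rational, and `q ^ 2 Δ` is an integer.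
  have hq : ∃ q : ℚ, l - θ = q * Real.sqrt Δ := by
    have h1 : l - θ = (b l / b l₀ : ℚ) * (l₀ - θ) := by
      have h2 := hb l hl
      have h3 := hb l₀ hl₀
      push_cast
      have h4 : l - θ = b l * c := by linarith
      have h5 : l₀ - θ = b l₀ * c := by linarith
      rw [h4, h5]
      field_simp
    rcases sq_eq_sq_iff_eq_or_eq_neg.1 hD2 with h | h
    · exact ⟨b l / b l₀ * s, by rw [h1, h]; push_cast; ring⟩
    · exact ⟨-(b l / b l₀ * s), by rw [h1, h]; push_cast; ring⟩
  obtain ⟨q, hq⟩ := hq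
  obtain ⟨t, ht⟩ := hsq l hl
  obtain ⟨n, hn⟩ := exists_int_of_sq_eq hsf (q := q) (s := t) (by
    rw [hq, mul_pow, Real.sq_sqrt hΔ0.le] at ht
    exact_mod_cast ht)
  exact ⟨n, by rw [hn] at hq; push_cast at hq; linarith⟩

end QuantumWalk

namespace QuantumWalk

open Polynomial UniqueFactorizationMonoid

variable {V : Type*} [Fintype V] [DecidableEq V] {M : Matrix V V ℝ} {u v : V} {θ : ℝ}

theorem map_aeval_apply {F K L : Type*} [CommRing F] [CommRing K] [CommRing L] [Algebra F K]
    [Algebra F L] (φ : K →ₐ[F] L) (A : Matrix V V F) (q : K[X]) (a b : V) :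
    φ ((aeval (A.map (algebraMap F K)) q) a b) =
      (aeval (A.map (algebraMap F L)) (q.map (φ : K →+* L))) a b := by
  have hA : φ.mapMatrix (A.map (algebraMap F K)) = A.map (algebraMap F L) := by
    ext i j
    simp
  have h : φ.mapMatrix (aeval (A.map (algebraMap F K)) q) =
      aeval (A.map (algebraMap F L)) (q.map (φ : K →+* L)) := by
    rw [← hA]
    induction q using Polynomial.induction_on' with
    | add p q hp hq => rw [map_add, map_add, hp, hq, Polynomial.map_add, map_add]
    | monomial n x =>
      rw [Polynomial.map_monomial, aeval_monomial, aeval_monomial, map_mul, map_pow]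
      congr 1
      ext i j
      by_cases hij : i = j
      · subst hij; simp [Matrix.algebraMap_matrix_apply]
      · simp [Matrix.algebraMap_matrix_apply, hij]
  exact congrFun (congrFun h a) b

/-- The cofactor `m / (X - x)` of a root `x` of the squarefree part `m` of the characteristic
polynomial is a multiple of the Lagrange polynomial which selects the eigenvalue `x`. Its
`(u, u)`-entry at `M` is `m'(x)` times the mass at `x`, so that it detects whether `x` lies in the
support of `u`. As it depends algebraically on `x` with rational coefficients, conjugate eigenvalues
lie in the support simultaneously. -/
theorem supportConjClosed_of_rational (hM : M.IsHermitian) (A : Matrix V V ℚ)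
    (hA : M = A.map (algebraMap ℚ ℝ)) (u : V) : SupportConjClosed M u := by
  intro l hl k hk
  set m : ℚ[X] := radical A.charpoly with hm
  have hA0 : A.charpoly ≠ 0 := (Matrix.charpoly_monic A).ne_zero
  have hchar : A.charpoly.map (algebraMap ℚ ℝ) = M.charpoly := by
    rw [hA, ← Matrix.charpoly_map]
  have hsep : m.Separable := PerfectField.separable_iff_squarefree.2 squarefree_radical
  have hroot : ∀ x ∈ support M u, aeval x m = 0 := by
    intro x hx
    have h1 : aeval x A.charpoly = 0 := by
      rw [← eval_map_algebraMap, hchar]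
      exact isRoot_charpoly_of_mem_support hx
    have hint : IsIntegral ℚ x := ⟨A.charpoly, Matrix.charpoly_monic A, h1⟩
    have h2 : minpoly ℚ x ∣ m :=
      (dvd_radical_iff_of_irreducible (minpoly.irreducible hint) hA0).2 (minpoly.dvd ℚ x h1)
    obtain ⟨g, hg⟩ := h2
    rw [hg, map_mul, minpoly.aeval, zero_mul]
  have hml : minpoly ℚ l ∣ m := minpoly.dvd ℚ l (hroot l hl)
  have hmk : aeval k m = 0 := by
    obtain ⟨g, hg⟩ := hml
    rw [hg, map_mul, hk.aeval_eq_zero, zero_mul]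
  have hint : IsIntegral ℚ l :=
    ⟨A.charpoly, Matrix.charpoly_monic A, by
      rw [eval₂_eq_eval_map, hchar]
      exact isRoot_charpoly_of_mem_support hl⟩
  have : Fact (Irreducible (minpoly ℚ l)) := ⟨minpoly.irreducible hint⟩
  let K := AdjoinRoot (minpoly ℚ l)
  let φ : ∀ x : ℝ, aeval x (minpoly ℚ l) = 0 → K →ₐ[ℚ] ℝ := fun x hx =>
    AdjoinRoot.liftAlgHom (minpoly ℚ l) (Algebra.ofId ℚ ℝ) x hx
  let q : K[X] := m.map (algebraMap ℚ K) /ₘ (X - C (AdjoinRoot.root _))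
  let e : K := (aeval (A.map (algebraMap ℚ K)) q) u u
  have hq : ∀ x hx, q.map (φ x hx : K →+* ℝ) = m.map (algebraMap ℚ ℝ) /ₘ (X - C x) := by
    intro x hx
    rw [Polynomial.map_divByMonic _ (monic_X_sub_C _), Polynomial.map_map, Polynomial.map_sub,
      map_X, map_C]
    congr 2
    · exact (φ x hx).comp_algebraMap
    · exact congrArg _ (AdjoinRoot.liftAlgHom_root _ _ x hx)
  have he : ∀ x hx, φ x hx e = ∑ y ∈ support M u,
      (m.map (algebraMap ℚ ℝ) /ₘ (X - C x)).eval y * mass M y u := by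
    intro x hx
    rw [map_aeval_apply, ← hA, hq, aeval_apply_self hM]
  have hvanish : ∀ x, aeval x m = 0 → ∀ y ∈ support M u, y ≠ x →
      (m.map (algebraMap ℚ ℝ) /ₘ (X - C x)).eval y = 0 := by
    intro x hx y hy hyx
    have h1 := mul_divByMonic_eq_iff_isRoot.2 (show IsRoot (m.map (algebraMap ℚ ℝ)) x by
      rw [IsRoot.def, eval_map_algebraMap, hx])
    have h2 := congrArg (eval y) h1
    rw [eval_mul, eval_map_algebraMap, hroot y hy, eval_sub, eval_X, eval_C] at h2
    exact (mul_eq_zero.1 h2).resolve_left (sub_ne_zero.2 hyx)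
  have hl0 : aeval l (minpoly ℚ l) = 0 := minpoly.aeval ℚ l
  have hk0 : aeval k (minpoly ℚ l) = 0 := hk.aeval_eq_zero
  have hne : φ l hl0 e ≠ 0 := by
    rw [he, Finset.sum_eq_single_of_mem l hl fun y hy hyl => by
      rw [hvanish l (hroot l hl) y hy hyl, zero_mul]]
    refine mul_ne_zero ?_ (mass_pos_iff.2 (mem_support_iff.1 hl)).ne'
    have h1 := divByMonic_add_X_sub_C_mul_derivative_divByMonic_eq_derivative
      (m.map (algebraMap ℚ ℝ)) l
    have h2 := congrArg (eval l) h1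
    rw [eval_add, eval_mul, eval_sub, eval_X, eval_C, sub_self, zero_mul, add_zero,
      derivative_map, eval_map_algebraMap] at h2
    rw [h2]
    exact hsep.aeval_derivative_ne_zero (hroot l hl)
  have hne' : φ k hk0 e ≠ 0 := by
    intro h0
    apply hne
    rw [(map_eq_zero (φ k hk0)).1 h0, map_zero]
  rw [he] at hne'
  obtain ⟨y, hy, hy0⟩ := Finset.exists_ne_zero_of_sum_ne_zero hne'
  by_contra hkS
  refine hy0 ?_
  rw [hvanish k hmk y hy (fun h => hkS (h ▸ hy)), zero_mul]

end QuantumWalk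

/-! ### Twins -/

namespace WeightedGraph

variable {V : Type*} {X : WeightedGraph V} {ω η : ℝ} {T : Finset V}

theorem Twins.weight_eq {u v : V} (h : X.Twins u v) {w : V} (hu : w ≠ u) (hv : w ≠ v) :
    X.weight u w = X.weight v w := by
  by_cases hw : w ∈ X.nbhd u \ {u, v}
  · exact h.2.1 w hw
  · have hw' : w ∉ X.nbhd v \ {u, v} := h.1 ▸ hw
    have key : ∀ a, w ∉ X.nbhd a \ {u, v} → X.weight a w = 0 := by
      intro a ha
      by_contra h0
      refine ha ⟨lt_of_le_of_ne (X.weight_nonneg a w) (Ne.symm h0), ?_⟩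
      simp [hu, hv]
    rw [key u hw, key v hw']

variable [Fintype V] [DecidableEq V]

theorem IsTwinFamily.deg_eq (h : X.IsTwinFamily ω η T) {u v : V} (hu : u ∈ T) (hv : v ∈ T) :
    X.deg u = X.deg v := by
  by_cases huv : u = v
  · rw [huv]
  have h1 : ∀ a b : V, a ∈ T → b ∈ T → a ≠ b →
      X.deg a = 2 * ω + (η + ∑ j ∈ (Finset.univ.erase a).erase b, X.weight a j) := by
    intro a b ha hb hab
    rw [deg, h.2.2.1 a ha, ← Finset.add_sum_erase (Finset.univ.erase a) (X.weight a)
      (Finset.mem_erase.2 ⟨hab.symm, Finset.mem_univ b⟩), h.2.2.2 a ha b hb hab]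
  rw [h1 u v hu hv huv, h1 v u hv hu (Ne.symm huv), Finset.erase_right_comm]
  congr 2
  refine Finset.sum_congr rfl fun j hj => ?_
  simp only [Finset.mem_erase] at hj
  exact (h.2.1 u hu v hv huv).weight_eq hj.1 hj.2.1

theorem isHermitian_genAdj (X : WeightedGraph V) (q : ℝ) : (X.genAdj q).IsHermitian := by
  ext i j
  by_cases hij : i = j
  · subst hij; simp
  · simp [genAdj, adjMat, Matrix.diagonal_apply_ne _ hij, Matrix.diagonal_apply_ne _ (Ne.symm hij),
      X.weight_symm i j]

/-- Differences of twins are eigenvectors. -/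
theorem IsTwinFamily.sub_mem_eigenspace (h : X.IsTwinFamily ω η T) (q : ℝ) {u₀ u v : V}
    (hu₀ : u₀ ∈ T) (hu : u ∈ T) (hv : v ∈ T) :
    EuclideanSpace.single u (1 : ℝ) - EuclideanSpace.single v 1 ∈
      Module.End.eigenspace (Matrix.toEuclideanLin (X.genAdj q)) (q * X.deg u₀ + ω - η) := by
  by_cases huv : u = v
  · simp [huv]
  rw [Module.End.mem_eigenspace_iff]
  have hdu := h.deg_eq hu hu₀
  have hdv := h.deg_eq hv hu₀
  ext a
  have h1 : (Matrix.toEuclideanLin (X.genAdj q)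
      (EuclideanSpace.single u (1 : ℝ) - EuclideanSpace.single v 1)) a =
      X.genAdj q a u - X.genAdj q a v := by
    simp [map_sub]
  rw [h1]
  by_cases hau : a = u
  · subst hau
    simp [genAdj, adjMat, huv, h.2.2.1 a hu, h.2.2.2 a hu v hv huv, hdu]
  · by_cases hav : a = v
    · subst hav
      simp [genAdj, adjMat, hau, h.2.2.1 a hv, h.2.2.2 a hv u hu (Ne.symm huv), hdv]
    · have h2 := (h.2.1 u hu v hv huv).weight_eq hau hav
      rw [X.weight_symm u a, X.weight_symm v a] at h2
      simp [genAdj, adjMat, hau, hav, h2]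

end WeightedGraph

namespace QuantumWalk

open scoped InnerProductSpace

variable {V : Type*} [Fintype V] [DecidableEq V] {M : Matrix V V ℝ} {u v : V} {θ : ℝ}

/-- If `e_u - e_v` is an eigenvector for `θ`, it is fixed by the projection `E_θ`. -/
theorem projVec_sub_projVec
    (h : EuclideanSpace.single u (1 : ℝ) - EuclideanSpace.single v 1 ∈
      Module.End.eigenspace (Matrix.toEuclideanLin M) θ) :
    projVec M θ u - projVec M θ v =
      EuclideanSpace.single u (1 : ℝ) - EuclideanSpace.single v 1 := by
  rw [projVec, projVec, ← map_sub]
  exact Submodule.starProjection_eq_self_iff.2 h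

theorem projVec_eq_projVec_of_ne (hM : M.IsHermitian)
    (h : EuclideanSpace.single u (1 : ℝ) - EuclideanSpace.single v 1 ∈
      Module.End.eigenspace (Matrix.toEuclideanLin M) θ) {l : ℝ} (hl : l ≠ θ) :
    projVec M l u = projVec M l v := by
  have h2 : projVec M l u - projVec M l v ∈ Module.End.eigenspace (Matrix.toEuclideanLin M) l :=
    Submodule.sub_mem _ (projVec_mem l u) (projVec_mem l v)
  have h3 : ⟪projVec M l u - projVec M l v, projVec M l u - projVec M l v⟫_ℝ = 0 := by
    have h4 := inner_eigenspaces hM hl h2 h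
    rw [inner_sub_right, EuclideanSpace.inner_single_right, EuclideanSpace.inner_single_right] at h4
    rw [inner_sub_left, inner_projVec_of_mem h2, inner_projVec_of_mem h2]
    simpa using h4
  exact sub_eq_zero.1 (inner_self_eq_zero.1 h3)

/-- With `c` the common value `(E_θ)_{u,v}`, both masses at `θ` are `1 + c`. -/
theorem projVec_apply_of_sub_mem (huv : u ≠ v)
    (h : EuclideanSpace.single u (1 : ℝ) - EuclideanSpace.single v 1 ∈
      Module.End.eigenspace (Matrix.toEuclideanLin M) θ) :
    projVec M θ u v = mass M θ u - 1 ∧ projVec M θ v u = mass M θ u - 1 ∧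
      mass M θ v = mass M θ u := by
  have h0 := projVec_sub_projVec h
  have h1 := congrArg (fun x : EuclideanSpace ℝ V => x u) h0
  have h2 := congrArg (fun x : EuclideanSpace ℝ V => x v) h0
  have h3 : projVec M θ u v = projVec M θ v u := by
    rw [← inner_projVec_of_mem (projVec_mem θ u) v, ← inner_projVec_of_mem (projVec_mem θ v) u,
      real_inner_comm]
  simp [projVec_apply_self, huv, Ne.symm huv] at h1 h2
  refine ⟨by linarith, by linarith, by linarith⟩

theorem norm_sq_projVec_add (huv : u ≠ v)
    (h : EuclideanSpace.single u (1 : ℝ) - EuclideanSpace.single v 1 ∈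
      Module.End.eigenspace (Matrix.toEuclideanLin M) θ) :
    ‖projVec M θ u + projVec M θ v‖ ^ 2 = 4 * mass M θ u - 2 := by
  obtain ⟨h1, -, h3⟩ := projVec_apply_of_sub_mem huv h
  rw [norm_add_sq_real, real_inner_comm, inner_projVec_of_mem (projVec_mem θ u), h1]
  change mass M θ u + _ + mass M θ v = _
  rw [h3]
  ring

theorem half_le_mass (huv : u ≠ v)
    (h : EuclideanSpace.single u (1 : ℝ) - EuclideanSpace.single v 1 ∈
      Module.End.eigenspace (Matrix.toEuclideanLin M) θ) : 1 / 2 ≤ mass M θ u := by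
  have := norm_sq_projVec_add huv h
  have := sq_nonneg ‖projVec M θ u + projVec M θ v‖
  linarith

theorem projVec_eq_neg_iff (huv : u ≠ v)
    (h : EuclideanSpace.single u (1 : ℝ) - EuclideanSpace.single v 1 ∈
      Module.End.eigenspace (Matrix.toEuclideanLin M) θ) :
    projVec M θ u = -projVec M θ v ↔ mass M θ u = 1 / 2 := by
  rw [eq_neg_iff_add_eq_zero, ← norm_eq_zero, ← sq_eq_zero_iff, norm_sq_projVec_add huv h]
  constructor <;> intro h <;> linarith

theorem stronglyCospectral_iff (hM : M.IsHermitian) (huv : u ≠ v)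
    (h : EuclideanSpace.single u (1 : ℝ) - EuclideanSpace.single v 1 ∈
      Module.End.eigenspace (Matrix.toEuclideanLin M) θ) :
    StronglyCospectral M u v ↔ mass M θ u = 1 / 2 := by
  rw [← projVec_eq_neg_iff huv h]
  have hθ : θ ∈ eigenvalues M := by
    by_contra hθ
    have := half_le_mass huv h
    rw [mass, projVec_eq_zero_of_notMem hθ] at this
    norm_num at this
  constructor
  · intro hs
    refine (hs θ hθ).resolve_left fun h1 => ?_
    have h2 := congrArg (fun x : EuclideanSpace ℝ V => x u) (projVec_sub_projVec h)
    simp [h1, huv] at h2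
  · intro hθ l _
    by_cases hl : l = θ
    · subst hl
      exact Or.inr hθ
    · exact Or.inl (projVec_eq_projVec_of_ne hM h hl)

theorem hasExtraEigenvector_iff (huv : u ≠ v)
    (h : EuclideanSpace.single u (1 : ℝ) - EuclideanSpace.single v 1 ∈
      Module.End.eigenspace (Matrix.toEuclideanLin M) θ) :
    HasExtraEigenvector M θ u v ↔ 1 / 2 < mass M θ u := by
  constructor
  · rintro ⟨w, hw, horth, hne⟩
    refine lt_of_le_of_ne (half_le_mass huv h) fun h0 => ?_
    have hw' : WithLp.toLp 2 w ∈ Module.End.eigenspace (Matrix.toEuclideanLin M) θ := by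
      rw [Module.End.mem_eigenspace_iff]
      ext a
      simpa using congrFun hw a
    have h1 := inner_projVec_of_mem hw' u
    have h2 := inner_projVec_of_mem hw' v
    rw [(projVec_eq_neg_iff huv h).2 h0.symm, inner_neg_left, h2] at h1
    rw [dotProduct_sub, dotProduct_single_one, dotProduct_single_one] at horth
    simp only at h1
    rcases hne with hne | hne <;> exact hne (by linarith)
  · intro hlt
    obtain ⟨h1, h2, h3⟩ := projVec_apply_of_sub_mem huv h
    refine ⟨(projVec M θ u + projVec M θ v).ofLp, ?_, ?_, Or.inl ?_⟩
    · rw [WithLp.ofLp_add, Matrix.mulVec_add, mulVec_projVec, mulVec_projVec, smul_add]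
    · rw [dotProduct_sub, dotProduct_single_one, dotProduct_single_one]
      simp only [WithLp.ofLp_add, Pi.add_apply, projVec_apply_self, h1, h2, h3]
      ring
    · simp only [WithLp.ofLp_add, Pi.add_apply, projVec_apply_self, h2]
      intro h0
      linarith

theorem plusSupport_eq_erase (hM : M.IsHermitian) (huv : u ≠ v)
    (h : EuclideanSpace.single u (1 : ℝ) - EuclideanSpace.single v 1 ∈
      Module.End.eigenspace (Matrix.toEuclideanLin M) θ) :
    plusSupport M u v = (support M u).erase θ := by
  ext l
  rw [plusSupport, Finset.mem_filter, Finset.mem_erase, and_comm]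
  refine and_congr_left fun _ => ⟨?_, projVec_eq_projVec_of_ne hM h⟩
  rintro hl rfl
  have h2 := congrArg (fun x : EuclideanSpace ℝ V => x u) (projVec_sub_projVec h)
  simp [hl, huv] at h2

/-- The projections of the orthogonal vectors `e_u` and `e_v` pair to zero in total, which a
dominating eigenvalue prevents if all of them agree up to sign. -/
theorem not_stronglyCospectral_of_half_lt_mass (hM : M.IsHermitian) (h : 1 / 2 < mass M θ u)
    (hvu : v ≠ u) : ¬ StronglyCospectral M u v := by
  classical
  intro hs
  have habs : ∀ l ∈ eigenvalues M, |projVec M l v u| = mass M l u := by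
    intro l hl
    have h1 : projVec M l u = projVec M l v ∨ projVec M l u = -projVec M l v := hs l hl
    rw [← abs_of_nonneg (mass_nonneg (M := M) l u), ← projVec_apply_self]
    rcases h1 with h1 | h1
    · rw [h1]
    · rw [h1, PiLp.neg_apply, abs_neg]
  have hθ : θ ∈ eigenvalues M := by
    by_contra hθ
    rw [mass, projVec_eq_zero_of_notMem hθ] at h
    norm_num at h
  have h0 := congrArg (fun x : EuclideanSpace ℝ V => x u) (sum_projVec hM v)
  simp only [WithLp.ofLp_sum, Finset.sum_apply] at h0
  rw [← Finset.add_sum_erase _ (fun l => projVec M l v u) hθ] at h0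
  have h1 : |∑ l ∈ (eigenvalues M).erase θ, projVec M l v u| ≤
      ∑ l ∈ (eigenvalues M).erase θ, mass M l u :=
    (Finset.abs_sum_le_sum_abs _ _).trans_eq
      (Finset.sum_congr rfl fun l hl => habs l (Finset.mem_of_mem_erase hl))
  have h2 := sum_mass_eigenvalues hM u
  rw [← Finset.add_sum_erase _ _ hθ] at h2
  have h3 : projVec M θ v u = -∑ l ∈ (eigenvalues M).erase θ, projVec M l v u := by
    simp [Ne.symm hvu] at h0
    linarith
  have h4 := habs θ hθ
  rw [h3, abs_neg] at h4
  linarith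

/-- With three twins, `e_u + e_v - 2 e_w` is an eigenvector orthogonal to `e_u - e_v`. -/
theorem half_lt_mass_of_three {w : V} (huv : u ≠ v) (huw : u ≠ w) (hvw : v ≠ w)
    (hv : EuclideanSpace.single u (1 : ℝ) - EuclideanSpace.single v 1 ∈
      Module.End.eigenspace (Matrix.toEuclideanLin M) θ)
    (hw : EuclideanSpace.single u (1 : ℝ) - EuclideanSpace.single w 1 ∈
      Module.End.eigenspace (Matrix.toEuclideanLin M) θ) : 1 / 2 < mass M θ u := by
  refine (hasExtraEigenvector_iff huv hv).1 ?_
  refine ⟨Pi.single u 1 + Pi.single v 1 - 2 * Pi.single w 1, ?_, ?_, Or.inl ?_⟩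
  · have h1 := Submodule.sub_mem _ (Submodule.smul_mem _ (2 : ℝ) hw) hv
    have h2 := congrArg WithLp.ofLp (Module.End.mem_eigenspace_iff.1 h1)
    have h3 : (Pi.single u 1 + Pi.single v 1 - 2 * Pi.single w 1 : V → ℝ) =
        ((2 : ℝ) • (EuclideanSpace.single u (1 : ℝ) - EuclideanSpace.single w 1) -
          (EuclideanSpace.single u (1 : ℝ) - EuclideanSpace.single v 1)).ofLp := by
      ext a
      simp [Pi.single_apply]
      split_ifs <;> ring
    rw [h3]
    exact h2
  · rw [dotProduct_sub, dotProduct_single_one, dotProduct_single_one]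
    simp [huv, huw, hvw, Ne.symm huv]
  · simp [huv, huw]

/-- A simple eigenvalue `θ` has eigenspace spanned by `e_u - e_v`. -/
theorem mass_eq_half_of_isSimpleEigenvalue (huv : u ≠ v)
    (h : EuclideanSpace.single u (1 : ℝ) - EuclideanSpace.single v 1 ∈
      Module.End.eigenspace (Matrix.toEuclideanLin M) θ) (hs : IsSimpleEigenvalue M θ) :
    mass M θ u = 1 / 2 := by
  have hfin : Module.finrank ℝ (Module.End.eigenspace (Matrix.toEuclideanLin M) θ) ≤ 1 := by
    have h1 := LinearMap.finrank_genEigenspace_le (Matrix.toEuclideanLin M) θ 1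
    rw [charpoly_toEuclideanLin, hs] at h1
    exact h1
  obtain ⟨x, hx⟩ := finrank_le_one_iff.1 hfin
  obtain ⟨a, ha⟩ := hx ⟨_, h⟩
  obtain ⟨b, hb⟩ := hx ⟨_, projVec_mem θ u⟩
  replace ha := congrArg Subtype.val ha
  replace hb := congrArg Subtype.val hb
  have hau := congrArg (fun y : EuclideanSpace ℝ V => y u) ha
  have hav := congrArg (fun y : EuclideanSpace ℝ V => y v) ha
  have hbu := congrArg (fun y : EuclideanSpace ℝ V => y u) hb
  have hbv := congrArg (fun y : EuclideanSpace ℝ V => y v) hb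
  obtain ⟨h1, -, -⟩ := projVec_apply_of_sub_mem huv h
  simp [huv, Ne.symm huv, projVec_apply_self, h1] at hau hav hbu hbv
  have h5 : a * ((x : EuclideanSpace ℝ V) u + (x : EuclideanSpace ℝ V) v) = 0 := by
    rw [mul_add, hau, hav]; norm_num
  have ha0 : a ≠ 0 := by rintro rfl; simp at hau
  have h6 := (mul_eq_zero.1 h5).resolve_left ha0
  have h7 : b * ((x : EuclideanSpace ℝ V) u + (x : EuclideanSpace ℝ V) v) =
    mass M θ u + (mass M θ u - 1) := by rw [mul_add, hbu, hbv]
  rw [h6, mul_zero] at h7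
  linarith

end QuantumWalk

namespace QuantumWalk

variable {V : Type*} [Fintype V] [DecidableEq V] {M : Matrix V V ℝ} {u v : V} {θ : ℝ}

theorem isSedentary_iff_hasOddRelation (hM : M.IsHermitian) (huv : u ≠ v)
    (h : EuclideanSpace.single u (1 : ℝ) - EuclideanSpace.single v 1 ∈
      Module.End.eigenspace (Matrix.toEuclideanLin M) θ) (hs : StronglyCospectral M u v) :
    IsSedentary M u ↔ HasOddRelation M θ u v := by
  have hθ := (stronglyCospectral_iff hM huv h).1 hs
  rw [HasOddRelation, plusSupport_eq_erase hM huv h]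
  exact ⟨exists_odd_relation_of_isSedentary hM hθ,
    fun ⟨m, hm, hodd⟩ => isSedentary_of_odd_relation hM hθ m hm hodd⟩

theorem plusSupport_comm (u v : V) : plusSupport M u v = plusSupport M v u := by
  ext l
  simp only [plusSupport, Finset.mem_filter, mem_support_iff]
  constructor <;> rintro ⟨h1, h2⟩
  · exact ⟨h2 ▸ h1, h2.symm⟩
  · exact ⟨h2 ▸ h1, h2.symm⟩

theorem StronglyCospectral.symm (h : StronglyCospectral M u v) : StronglyCospectral M v u :=
  fun l hl => (h l hl).imp Eq.symm fun h => by rw [h, neg_neg]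

theorem HasOddRelation.symm (h : HasOddRelation M θ u v) : HasOddRelation M θ v u := by
  rwa [HasOddRelation, plusSupport_comm]

variable {T : Finset V}

theorem LargeOrExtra.half_lt_mass (h : LargeOrExtra M θ T)
    (hT : ∀ u ∈ T, ∀ v ∈ T, EuclideanSpace.single u (1 : ℝ) - EuclideanSpace.single v 1 ∈
      Module.End.eigenspace (Matrix.toEuclideanLin M) θ) (hu : u ∈ T) :
    1 / 2 < mass M θ u := by
  rcases h with h | ⟨a, b, hab, rfl, h⟩
  · have h1 : 1 < (T.erase u).card := by
      rw [Finset.card_erase_of_mem hu]; omega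
    obtain ⟨v, hv, w, hw, hvw⟩ := Finset.one_lt_card.1 h1
    rw [Finset.mem_erase] at hv hw
    exact half_lt_mass_of_three hv.1.symm hw.1.symm hvw (hT u hu v hv.2) (hT u hu w hw.2)
  · have hE := hT a (by simp) b (by simp)
    have h1 := (hasExtraEigenvector_iff hab hE).1 h
    rcases Finset.mem_insert.1 hu with rfl | hu
    · exact h1
    · rw [Finset.mem_singleton.1 hu, (projVec_apply_of_sub_mem hab hE).2.2]
      exact h1

theorem exists_stronglyCospectral_of_not_largeOrExtra (hM : M.IsHermitian) (hcard : 2 ≤ T.card)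
    (hT : ∀ u ∈ T, ∀ v ∈ T, EuclideanSpace.single u (1 : ℝ) - EuclideanSpace.single v 1 ∈
      Module.End.eigenspace (Matrix.toEuclideanLin M) θ) (h : ¬ LargeOrExtra M θ T) :
    ∃ u v : V, u ≠ v ∧ T = {u, v} ∧ StronglyCospectral M u v := by
  rw [LargeOrExtra, not_or] at h
  obtain ⟨u, v, huv, rfl⟩ := Finset.card_eq_two.1 (by omega : T.card = 2)
  have hE := hT u (by simp) v (by simp)
  refine ⟨u, v, huv, rfl, (stronglyCospectral_iff hM huv hE).2 ?_⟩
  refine le_antisymm (not_lt.1 fun hlt => h.2 ?_) (half_le_mass huv hE)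
  exact ⟨u, v, huv, rfl, (hasExtraEigenvector_iff huv hE).2 hlt⟩

end QuantumWalk

theorem theorem4p5 {V : Type*} [Fintype V] [DecidableEq V] (X : WeightedGraph V) (q ω η : ℝ)
    (T : Finset V) (hT : X.IsTwinSet ω η T) (M : Matrix V V ℝ) (hM : M = X.genAdj q)
    (u₀ : V) (hu₀ : u₀ ∈ T) (θ : ℝ) (hθ : θ = q * X.deg u₀ + ω - η) :
    ((∀ u ∈ T, QuantumWalk.IsSedentary M u) ↔
      QuantumWalk.LargeOrExtra M θ T ∨ QuantumWalk.CospectralPairWithOddRelation M θ T) ∧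
    (QuantumWalk.LargeOrExtra M θ T → ∀ u ∈ T, ∀ v : V, v ≠ u →
      ¬ QuantumWalk.StronglyCospectral M u v) ∧
    (¬ QuantumWalk.LargeOrExtra M θ T ↔
      ∃ u v : V, u ≠ v ∧ T = {u, v} ∧ QuantumWalk.StronglyCospectral M u v) ∧
    (QuantumWalk.IsSimpleEigenvalue M θ →
      ∃ u v : V, u ≠ v ∧ T = {u, v} ∧ QuantumWalk.StronglyCospectral M u v) ∧
    (∀ u v : V, u ≠ v → T = {u, v} → QuantumWalk.StronglyCospectral M u v →
      QuantumWalk.IsPeriodic M u →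
      (QuantumWalk.HasOddRelation M θ u v → QuantumWalk.IsTightlySedentary M u) ∧
      (QuantumWalk.HasOddRelation M θ u v ↔
        ∃ c : ℝ, 0 < c ∧ QuantumWalk.TwoAdicForm M θ c u v) ∧
      (QuantumWalk.HasIntegralCharpoly M → QuantumWalk.SupportConjClosed M u →
        (QuantumWalk.HasOddRelation M θ u v ↔
          ∃ Δ : ℕ, (Δ = 1 ∨ (1 < Δ ∧ Squarefree Δ)) ∧
            QuantumWalk.TwoAdicForm M θ (Real.sqrt (Δ : ℝ)) u v))) ∧
    ((∀ a b : V, ∃ r : ℚ, M a b = (r : ℝ)) → ∀ u ∈ T, QuantumWalk.SupportConjClosed M u) := by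
  open QuantumWalk in
  have hH : M.IsHermitian := hM ▸ X.isHermitian_genAdj q
  have hE : ∀ u ∈ T, ∀ v ∈ T, EuclideanSpace.single u (1 : ℝ) - EuclideanSpace.single v 1 ∈
      Module.End.eigenspace (Matrix.toEuclideanLin M) θ := fun u hu v hv => by
    rw [hM, hθ]
    exact hT.prop.sub_mem_eigenspace q hu₀ hu hv
  have hcard : 2 ≤ T.card := hT.prop.1
  have hpair : ∀ u v : V, T = {u, v} →
      EuclideanSpace.single u (1 : ℝ) - EuclideanSpace.single v 1 ∈
        Module.End.eigenspace (Matrix.toEuclideanLin M) θ := fun u v h =>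
    hE u (by simp [h]) v (by simp [h])
  refine ⟨⟨fun hs => ?_, ?_⟩, fun h u hu v hvu =>
    not_stronglyCospectral_of_half_lt_mass hH (h.half_lt_mass hE hu) hvu, ⟨fun h =>
    exists_stronglyCospectral_of_not_largeOrExtra hH hcard hE h, ?_⟩, fun hs => ?_, ?_, ?_⟩
  · by_cases hL : LargeOrExtra M θ T
    · exact Or.inl hL
    · obtain ⟨u, v, huv, hTuv, hsc⟩ :=
        exists_stronglyCospectral_of_not_largeOrExtra hH hcard hE hL
      exact Or.inr ⟨u, v, huv, hTuv, hsc, (isSedentary_iff_hasOddRelation hH huv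
        (hpair u v hTuv) hsc).1 (hs u (by simp [hTuv]))⟩
  · rintro (h | ⟨u, v, huv, hTuv, hsc, hodd⟩)
    · exact fun u hu => isSedentary_of_half_lt_mass hH (h.half_lt_mass hE hu)
    · intro w hw
      rw [hTuv, Finset.mem_insert, Finset.mem_singleton] at hw
      rcases hw with rfl | rfl
      · exact (isSedentary_iff_hasOddRelation hH huv (hpair w v hTuv) hsc).2 hodd
      · exact (isSedentary_iff_hasOddRelation hH huv.symm
          (hpair w u (hTuv.trans (Finset.pair_comm u w))) hsc.symm).2 hodd.symm
  · rintro ⟨u, v, huv, hTuv, hsc⟩ h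
    exact not_stronglyCospectral_of_half_lt_mass hH
      (h.half_lt_mass hE (by simp [hTuv] : u ∈ T)) huv.symm hsc
  · refine exists_stronglyCospectral_of_not_largeOrExtra hH hcard hE fun h => ?_
    obtain ⟨v, hv, hne⟩ := Finset.exists_mem_ne (by omega : 1 < T.card) u₀
    have := h.half_lt_mass hE hu₀
    rw [mass_eq_half_of_isSimpleEigenvalue hne.symm (hE u₀ hu₀ v hv) hs] at this
    exact lt_irrefl _ this
  · intro u v huv hTuv hsc hper
    have hd := hpair u v hTuv
    have hplus := plusSupport_eq_erase hH huv hd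
    have hθplus : θ ∉ plusSupport M u v := by rw [hplus]; simp
    have hθs : θ ∈ support M u := mem_support_iff.2 (mass_pos_iff.1 (by
      rw [(stronglyCospectral_iff hH huv hd).1 hsc]; norm_num))
    have hsub : ∀ l ∈ plusSupport M u v, l ∈ support M u := fun l hl =>
      (Finset.mem_filter.1 hl).1
    refine ⟨fun hodd => hper.isTightlySedentary hH
      ((isSedentary_iff_hasOddRelation hH huv hd hsc).2 hodd), ⟨fun hodd => ?_, ?_⟩,
      fun hint hcl => ⟨fun hodd => ?_, ?_⟩⟩
    · obtain ⟨c, hc, b, hb⟩ := exists_arith_prog_of_isPeriodic hH hper hθs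
      exact ⟨c, hc, hodd.twoAdicForm hc.ne' hθplus fun l hl => ⟨b l, hb l (hsub l hl)⟩⟩
    · rintro ⟨c, hc, h⟩
      exact h.hasOddRelation hc.ne' hθplus
    · obtain ⟨Δ, hΔ, hb⟩ := exists_squarefree_of_isPeriodic hH hint hcl hper hθs
      have hpos := Nat.pos_of_ne_zero hΔ.ne_zero
      refine ⟨Δ, ?_, hodd.twoAdicForm (Real.sqrt_pos.2 (by exact_mod_cast hpos)).ne' hθplus
        fun l hl => hb l (hsub l hl)⟩
      rcases Nat.eq_or_lt_of_le hpos with h | h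
      · exact Or.inl h.symm
      · exact Or.inr ⟨h, hΔ⟩
    · rintro ⟨Δ, hΔ, h⟩
      have hpos : 0 < Δ := by omega
      exact h.hasOddRelation (Real.sqrt_pos.2 (by exact_mod_cast hpos)).ne' hθplus
  · intro hrat u _
    choose r hr using hrat
    exact supportConjClosed_of_rational hH (Matrix.of r) (by ext a b; simp [hr]) u
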